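/- Let $D_1, D_2\subset\mathbb{R}^3$ be balls of radii $r_1,r_2>0$ whose boundary spheres are separated by a distance $\epsilon>0$ (that is, the centres are at distance $r_1+r_2+\epsilon$), and let $D=D_1\cup D_2$. Let $\mathcal{S}_D$ be the Laplace single layer potential, $$\mathcal{S}_D[\phi](x)=-\frac{1}{4\pi}\int_{\partial D}\frac{\phi(y)}{|x-y|}\,\mathrm{d}\sigma(y),\qquad \phi\in L^2(\partial D),$$ where $\sigma$ is surface measure, and let $\psi_1,\psi_2\in L^2(\partial D)$ satisfy $\mathcal{S}_D[\psi_j]=1$ on $\partial D_j$ and $\mathcal{S}_D[\psi_j]=0$ on $\partial D\setminus\partial D_j$ (almost everywhere). The capacitance coefficients are $$C_{ij}:=-\int_{\partial D_i}\psi_j\,\mathrm{d}\sigma,\qquad i,j=1,2.$$ Put $$\alpha:=\frac{\sqrt{\epsilon(2r_1+\epsilon)(2r_2+\epsilon)(2r_1+2r_2+\epsilon)}}{2(r_1+r_2+\epsilon)},\qquad \xi_i:=\sinh^{-1}\left(\frac{\alpha}{r_i}\right).$$ Then such $\psi_1,\psi_2$ exist, and for every such choice the capacitance coefficients are given by the convergent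 series $$C_{11}=8\pi\alpha\sum_{n=0}^{\infty}\frac{e^{(2n+1)\xi_2}}{e^{(2n+1)(\xi_1+\xi_2)}-1},\qquad C_{22}=8\pi\alpha\sum_{n=0}^{\infty}\frac{e^{(2n+1)\xi_1}}{e^{(2n+1)(\xi_1+\xi_2)}-1},$$ $$C_{12}=C_{21}=-8\pi\alpha\sum_{n=0}^{\infty}\frac{1}{e^{(2n+1)(\xi_1+\xi_2)}-1}.$$ -/

import Mathlib

open MeasureTheory

noncomputable section

/-- Surface measure of the sphere `∂B(c, r)` in `ℝ³` (for `r > 0`), as a measure on `ℝ³`: the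
surface measure of the unit sphere pushed forward along `u ↦ c + r u` and scaled by `r ^ 2`. -/
def sphereMeasure (c : EuclideanSpace ℝ (Fin 3)) (r : ℝ) : Measure (EuclideanSpace ℝ (Fin 3)) :=
  ENNReal.ofReal (r ^ 2) •
    (volume : Measure (EuclideanSpace ℝ (Fin 3))).toSphere.map
      (fun u : Metric.sphere (0 : EuclideanSpace ℝ (Fin 3)) 1 =>
        c + r • (u : EuclideanSpace ℝ (Fin 3)))

/-- Surface measure of `∂D`, where `D` is the union of the two balls `D i = B(c i, r i)`
with disjoint closures. -/
def boundaryMeasure (c : Fin 2 → EuclideanSpace ℝ (Fin 3)) (r : Fin 2 → ℝ) :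
    Measure (EuclideanSpace ℝ (Fin 3)) :=
  ∑ i, sphereMeasure (c i) (r i)

/-- Laplace single layer potential `S_D[φ](x) = -(1 / 4π) ∫_{∂D} φ(y) / |x - y| dσ(y)`. -/
def singleLayer (c : Fin 2 → EuclideanSpace ℝ (Fin 3)) (r : Fin 2 → ℝ)
    (φ : EuclideanSpace ℝ (Fin 3) → ℂ) (x : EuclideanSpace ℝ (Fin 3)) : ℂ :=
  ∫ y, ((-(1 / (4 * Real.pi * ‖x - y‖)) : ℝ) : ℂ) * φ y ∂boundaryMeasure c r

/-- `ψ` is a family of densities `ψ j ∈ L²(∂D)` such that, as elements of `L²(∂D)`,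
`S_D[ψ j] = 1` on `∂D j` and `S_D[ψ j] = 0` on the other component of `∂D`. -/
def IsCapacitanceDensity (c : Fin 2 → EuclideanSpace ℝ (Fin 3)) (r : Fin 2 → ℝ)
    (ψ : Fin 2 → EuclideanSpace ℝ (Fin 3) → ℂ) : Prop :=
  ∀ j, MemLp (ψ j) 2 (boundaryMeasure c r) ∧
    ∀ i, ∀ᵐ x ∂sphereMeasure (c i) (r i), singleLayer c r (ψ j) x = if i = j then 1 else 0

/-- The capacitance matrix `C i j = -∫_{∂D i} ψ j dσ`. -/
def capacitanceMatrix (c : Fin 2 → EuclideanSpace ℝ (Fin 3)) (r : Fin 2 → ℝ)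
    (ψ : Fin 2 → EuclideanSpace ℝ (Fin 3) → ℂ) : Matrix (Fin 2) (Fin 2) ℂ :=
  Matrix.of fun i j => -∫ y, ψ j y ∂sphereMeasure (c i) (r i)

/-- Half the distance between the poles of the bispherical coordinates adapted to two spheres of
radii `r₁`, `r₂` whose surfaces are a distance `ε` apart. -/
def bisphericalAlpha (r₁ r₂ ε : ℝ) : ℝ :=
  Real.sqrt (ε * (2 * r₁ + ε) * (2 * r₂ + ε) * (2 * r₁ + 2 * r₂ + ε)) / (2 * (r₁ + r₂ + ε))

end

/-! The proof is the method of images. On the axis of centres, with unit vector `e` and origin `O`,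
the spheres ∂D_i and ∂D_j are the bispherical coordinate spheres τ = ξ_i and τ = -ξ_j. Put A = ξ_i +
ξ_j. Place charges α/sinh(ξ_i + mA) at O + α coth(ξ_i + mA) e inside D_i and -α/sinh(A + mA) at O -
α coth(A + mA) e inside D_j, for m ≥ 0. Their potentials cancel term by term on ∂D_j. On ∂D_i they
cancel after a shift of the index, which leaves the zeroth charge, r_i at the centre of D_i, whose
potential there is 1 (`div_norm_sub_eq_of_image`, `exists_image_density`).

To obtain densities on ∂D, each charge is swept onto its sphere: the Poisson kernel of an interior
point has, on and outside the sphere, the potential of a unit charge at that point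
(`lintegral_poisson_mul_inv_norm_sub`). An inversion preserving the unit sphere reduces this to
Newton's theorem, ∫ dσ(u)/|u - x| = 4π for |x| ≤ 1, and the same inversion also proves Newton's
theorem. The outcome is a bounded density φ_i with S[φ_i] = 1 on ∂D_i and 0 on the other sphere,
whose integrals are multiples of total charges.

Uniqueness of ψ is never needed. The kernel is symmetric, so ∫_{∂D_i} ψ_j = ∫ ψ_j S[φ_i] = ∫ φ_i
S[ψ_j] = ∫_{∂D_j} φ_i (`integral_sphere_eq_of_dual`). Expanding 1/(2 sinh t) = Σ e^{-(2n+1)t} and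
exchanging the two sums turns the charge series into the stated ones (`hasSum_exp_div_exp_sub_one`).
-/

/-! ### The chord involution of the sphere, extended homogeneously, and its Jacobian. -/

section ChordReflection

variable {E : Type*} [NormedAddCommGroup E] [InnerProductSpace ℝ E]

/-- The norm preserving, positively homogeneous map which on the unit sphere sends `x` to the second
point of intersection of the sphere with the line through `x` and `p`. -/
noncomputable def chordReflection (p x : E) : E :=
  x - (2 * inner ℝ x (x - ‖x‖ • p) / ‖x - ‖x‖ • p‖ ^ 2) • (x - ‖x‖ • p)

/-- The conformal factor of `chordReflection p`. -/
noncomputable def chordFactor (p x : E) : ℝ :=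
  ‖x‖ ^ 2 * (1 - ‖p‖ ^ 2) / ‖x - ‖x‖ • p‖ ^ 2

theorem sub_norm_smul_ne_zero {p x : E} (hp : ‖p‖ < 1) (hx : x ≠ 0) : x - ‖x‖ • p ≠ 0 := by
  intro h
  have h1 : ‖x‖ = ‖x‖ * ‖p‖ := by
    conv_lhs => rw [sub_eq_zero.1 h]
    rw [norm_smul, norm_norm]
  have h2 := norm_pos_iff.2 hx
  nlinarith

theorem norm_sq_sub_two_smul (w x : E) (hw : w ≠ 0) :
    ‖x - (2 * inner ℝ x w / ‖w‖ ^ 2) • w‖ ^ 2 = ‖x‖ ^ 2 := by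
  have hw' : ‖w‖ ≠ 0 := norm_ne_zero_iff.2 hw
  rw [norm_sub_sq_real, norm_smul, inner_smul_right, mul_pow, Real.norm_eq_abs, sq_abs]
  field_simp
  ring

theorem norm_chordReflection {p : E} (hp : ‖p‖ < 1) (x : E) : ‖chordReflection p x‖ = ‖x‖ := by
  by_cases hx : x = 0
  · simp [chordReflection, hx]
  · have := norm_sq_sub_two_smul _ x (sub_norm_smul_ne_zero hp hx)
    exact (sq_eq_sq₀ (norm_nonneg _) (norm_nonneg _)).1 this

theorem chordReflection_smul (p : E) (x : E) {t : ℝ} (ht : 0 < t) :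
    chordReflection p (t • x) = t • chordReflection p x := by
  have h : t • x - ‖t • x‖ • p = t • (x - ‖x‖ • p) := by
    rw [norm_smul, Real.norm_of_nonneg ht.le, smul_sub, smul_smul]
  rw [chordReflection, chordReflection, h, inner_smul_left, inner_smul_right, norm_smul,
    Real.norm_of_nonneg ht.le, smul_sub t x, conj_trivial]
  · have e : 2 * (t * (t * inner ℝ x (x - ‖x‖ • p))) / (t * ‖x - ‖x‖ • p‖) ^ 2 =
        2 * inner ℝ x (x - ‖x‖ • p) / ‖x - ‖x‖ • p‖ ^ 2 := by field_simp
    rw [e]; module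

theorem chordFactor_smul (p : E) (x : E) {t : ℝ} (ht : 0 < t) :
    chordFactor p (t • x) = chordFactor p x := by
  have h : t • x - ‖t • x‖ • p = t • (x - ‖x‖ • p) := by
    rw [norm_smul, Real.norm_of_nonneg ht.le, smul_sub, smul_smul]
  rw [chordFactor, chordFactor, h, norm_smul, norm_smul, Real.norm_of_nonneg ht.le]
  field_simp

theorem chordReflection_chordReflection {p : E} (hp : ‖p‖ < 1) (x : E) :
    chordReflection p (chordReflection p x) = x := by
  by_cases hx : x = 0
  · simp [chordReflection, hx]
  have hw := sub_norm_smul_ne_zero hp hx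
  have hy := norm_chordReflection hp x
  have hy0 : chordReflection p x ≠ 0 := by
    rw [← norm_ne_zero_iff, hy]; exact norm_ne_zero_iff.2 hx
  have hv := sub_norm_smul_ne_zero hp hy0
  have hyx : chordReflection p x = x - (2 * inner ℝ x (x - ‖x‖ • p) / ‖x - ‖x‖ • p‖ ^ 2) •
    (x - ‖x‖ • p) := rfl
  set y := chordReflection p x with hydef
  rw [chordReflection]
  rw [hy] at hv ⊢
  set w := x - ‖x‖ • p with hwdef
  set s := 2 * inner ℝ x w / ‖w‖ ^ 2 with hs
  -- The chord vector at the image is parallel to the old one, so the second application reflects in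
  -- the same hyperplane.
  have hvw : y - ‖x‖ • p = (1 - s) • w := by
    rw [hyx, hwdef]; module
  have hs1 : 1 - s ≠ 0 := by
    intro h; rw [hvw, h, zero_smul] at hv; exact hv rfl
  rw [hvw, norm_smul, inner_smul_right, Real.norm_eq_abs, mul_pow, sq_abs, smul_smul]
  have hw' : ‖w‖ ≠ 0 := norm_ne_zero_iff.2 hw
  have : 2 * ((1 - s) * inner ℝ y w) / ((1 - s) ^ 2 * ‖w‖ ^ 2) * (1 - s) = -s := by
    rw [hyx, inner_sub_left, inner_smul_left, real_inner_self_eq_norm_sq, conj_trivial]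
    field_simp
    rw [hs]
    field_simp
    ring
  rw [this, hyx]; module

/-- With λ = `chordFactor p x`, the inner factor fixes `x` and is -λ on the orthogonal complement of
`x`; the outer transvection is the reflection along the chord. In this factored form the determinant
can be read off. -/
theorem hasFDerivAt_chordReflection [CompleteSpace E] {p x : E} (hp : ‖p‖ < 1) (hx : x ≠ 0) :
    ∃ D : E →L[ℝ] E, HasFDerivAt (chordReflection p) D x ∧
      (D : E →ₗ[ℝ] E) =
        LinearMap.transvection
          ((-2 / ‖x - ‖x‖ • p‖ ^ 2) • (innerₛₗ ℝ (x - ‖x‖ • p) : E →ₗ[ℝ] ℝ)) (x - ‖x‖ • p) ∘ₗ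
        ((-chordFactor p x) • LinearMap.transvection
          ((-(1 + chordFactor p x) / (chordFactor p x * ‖x‖ ^ 2)) • (innerₛₗ ℝ x : E →ₗ[ℝ] ℝ)) x) := by
  have hN : ‖x‖ ≠ 0 := norm_ne_zero_iff.2 hx
  have hw := sub_norm_smul_ne_zero hp hx
  have hw' : ‖x - ‖x‖ • p‖ ≠ 0 := norm_ne_zero_iff.2 hw
  have hnorm : HasFDerivAt (fun y : E => ‖y‖) ((‖x‖⁻¹) • innerSL ℝ x) x := by
    have h1 := (hasStrictFDerivAt_norm_sq x).hasFDerivAt.sqrt (by positivity)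
    simp only [Real.sqrt_sq (norm_nonneg _)] at h1
    refine h1.congr_fderiv ?_
    ext v
    simp
    field_simp
  have hW : HasFDerivAt (fun y : E => y - ‖y‖ • p)
      (ContinuousLinearMap.id ℝ E - ((‖x‖⁻¹) • innerSL ℝ x).smulRight p) x :=
    (hasFDerivAt_id x).sub (hnorm.smul_const p)
  have hI := (hasFDerivAt_id x).inner ℝ hW
  have hQ := hW.norm_sq
  have hg := ((hI.const_mul 2).mul ((hasDerivAt_inv (x := ‖x - ‖x‖ • p‖ ^ 2) (by positivity)).comp_hasFDerivAt x hQ))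
  refine ⟨_, (hasFDerivAt_id x).sub (hg.smul hW), ?_⟩
  set w := x - ‖x‖ • p with hwdef
  ext v
  have hxw : x = w + ‖x‖ • p := by rw [hwdef]; module
  set X := inner ℝ x v with hX
  set N := ‖x‖ with hNdef
  have h1 : inner ℝ w v = X - N * inner ℝ p v := by
    rw [hwdef, inner_sub_left, inner_smul_left]; rfl
  have hxw' : inner ℝ x w = ‖w‖ ^ 2 + N * inner ℝ p w := by
    conv_lhs => rw [hxw]
    rw [inner_add_left, inner_smul_left, real_inner_self_eq_norm_sq]; rfl
  have hxp : inner ℝ x p = inner ℝ p w + N * ‖p‖ ^ 2 := by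
    conv_lhs => rw [hxw]
    rw [inner_add_left, inner_smul_left, real_inner_self_eq_norm_sq, real_inner_comm]; rfl
  have hNN : N ^ 2 = ‖w‖ ^ 2 + 2 * N * inner ℝ p w + N ^ 2 * ‖p‖ ^ 2 := by
    conv_lhs => rw [hNdef, hxw]
    rw [norm_add_sq_real, norm_smul, inner_smul_right, real_inner_comm, Real.norm_eq_abs, mul_pow,
      sq_abs]
    ring
  have hlam : chordFactor p x = (‖w‖ ^ 2 + 2 * N * inner ℝ p w) / ‖w‖ ^ 2 := by
    rw [chordFactor, ← hNdef, ← hwdef]; congr 1; linarith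
  have hlam0 : chordFactor p x ≠ 0 := by
    rw [chordFactor, ← hNdef, ← hwdef]
    have : 0 < 1 - ‖p‖ ^ 2 := by nlinarith [norm_nonneg p]
    positivity
  simp only [LinearMap.transvection.apply, ContinuousLinearMap.coe_coe, LinearMap.comp_apply,
    LinearMap.smul_apply, _root_.sub_apply, _root_.add_apply,
    _root_.smul_apply, ContinuousLinearMap.comp_apply,
    ContinuousLinearMap.smulRight_apply, ContinuousLinearMap.prod_apply,
    ContinuousLinearMap.coe_id', id, innerSL_apply_apply, innerₛₗ_apply_apply, fderivInnerCLM_apply,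
    Function.comp, smul_eq_mul, nsmul_eq_mul, inner_sub_right,
    inner_add_right, inner_smul_right, Pi.mul_apply, ← hNdef, ← hwdef, ← hX]
  rw [real_inner_comm x w, real_inner_comm p w, real_inner_comm w v, real_inner_self_eq_norm_sq,
    ← hNdef]
  clear hg hQ hI hW hnorm
  generalize chordFactor p x = l at *
  generalize inner ℝ x w = A at *
  generalize inner ℝ x p = B at *
  generalize inner ℝ w v = V at *
  generalize inner ℝ p w = Q at *
  generalize ‖p‖ ^ 2 = P at *
  clear_value X N w
  generalize ‖w‖ = W at *
  -- All inner products involving `p` are eliminated in favour of `N`, `W`, `l`; what remains is a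
  -- comparison of coefficients.
  have hB : B = (N ^ 2 - W ^ 2 - N * Q) / N := by
    rw [hxp]; field_simp; linarith
  rw [hxw, hB, hxw']
  have hll : l * W ^ 2 = W ^ 2 + 2 * N * Q := by rw [hlam]; field_simp
  have hQ : Q = (l - 1) * W ^ 2 / (2 * N) := by field_simp; linarith
  rw [hQ]
  match_scalars <;> field_simp <;> ring

theorem exists_hasFDerivAt_chordReflection_det [CompleteSpace E]
    (hdim : Module.finrank ℝ E = 3) {p x : E} (hp : ‖p‖ < 1) (hx : x ≠ 0) :
    ∃ D : E →L[ℝ] E, HasFDerivAt (chordReflection p) D x ∧ |D.det| = chordFactor p x ^ 2 := by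
  have : Module.Finite ℝ E := Module.finite_of_finrank_pos (by omega)
  obtain ⟨D, hD, h⟩ := hasFDerivAt_chordReflection hp hx
  refine ⟨D, hD, ?_⟩
  have hN : ‖x‖ ≠ 0 := norm_ne_zero_iff.2 hx
  have hw' : ‖x - ‖x‖ • p‖ ≠ 0 := norm_ne_zero_iff.2 (sub_norm_smul_ne_zero hp hx)
  have hl : chordFactor p x ≠ 0 := by
    rw [chordFactor]
    have : 0 < 1 - ‖p‖ ^ 2 := by nlinarith [norm_nonneg p]
    positivity
  -- In dimension 3 the three factors have determinants -1, (-λ)³ and -1/λ.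
  have : D.det = -chordFactor p x ^ 2 * (-1) ^ 2 := by
    rw [ContinuousLinearMap.det, h, LinearMap.det_comp, LinearMap.det_smul,
      LinearMap.transvection.det, LinearMap.transvection.det, hdim]
    simp only [LinearMap.smul_apply, innerₛₗ_apply_apply, real_inner_self_eq_norm_sq, smul_eq_mul]
    field_simp
    ring
  rw [this]
  simp

end ChordReflection

/-! ### Change of variables for surface measure on the unit sphere. -/

section SphereChangeOfVariables

open Metric

/-- Surface measure of the unit sphere of `ℝ³`. -/
noncomputable abbrev unitSphereMeasure : Measure (sphere (0 : EuclideanSpace ℝ (Fin 3)) 1) :=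
  (volume : Measure (EuclideanSpace ℝ (Fin 3))).toSphere

/-- Polar coordinates, with 3 the inverse of ∫₀¹ t² dt. Surface integrals become Lebesgue integrals,
to which the Jacobian formula applies. -/
theorem lintegral_unitSphereMeasure_eq_setLIntegral {f : EuclideanSpace ℝ (Fin 3) → ENNReal}
    (hf : Measurable f) :
    ∫⁻ u, f u ∂unitSphereMeasure =
      3 * ∫⁻ x in ball (0 : EuclideanSpace ℝ (Fin 3)) 1 \ {0}, f (‖x‖⁻¹ • x) := by
  have hmp := (volume : Measure (EuclideanSpace ℝ (Fin 3))).measurePreserving_homeomorphUnitSphereProd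
  have hS : MeasurableSet (Set.Iio (⟨1, Set.mem_Ioi.2 one_pos⟩ : Set.Ioi (0 : ℝ))) :=
    measurableSet_Iio
  have hfm : Measurable fun u : sphere (0 : EuclideanSpace ℝ (Fin 3)) 1 => f u :=
    hf.comp measurable_subtype_coe
  have hind : Measurable ((Set.Iio (⟨1, Set.mem_Ioi.2 one_pos⟩ : Set.Ioi (0 : ℝ))).indicator
      (1 : Set.Ioi (0 : ℝ) → ENNReal)) := measurable_one.indicator hS
  have h1 := hmp.lintegral_comp ((hfm.comp measurable_fst).mul (hind.comp measurable_snd))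
  have h2 := lintegral_prod_mul (μ := unitSphereMeasure) (ν := Measure.volumeIoiPow
    (Module.finrank ℝ (EuclideanSpace ℝ (Fin 3)) - 1)) hfm.aemeasurable hind.aemeasurable
  have h3 : ∫⁻ y, (Set.Iio (⟨1, Set.mem_Ioi.2 one_pos⟩ : Set.Ioi (0 : ℝ))).indicator
      (1 : Set.Ioi (0 : ℝ) → ENNReal) y ∂Measure.volumeIoiPow
    (Module.finrank ℝ (EuclideanSpace ℝ (Fin 3)) - 1) = 3⁻¹ := by
    rw [lintegral_indicator_one hS, Measure.volumeIoiPow_apply_Iio]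
    simp only [finrank_euclideanSpace, Fintype.card_fin]
    norm_num
    rw [ENNReal.ofReal_div_of_pos (by norm_num)]
    norm_num
  rw [h3] at h2
  simp only [Function.comp_def, Pi.mul_apply] at h1
  rw [h2] at h1
  have h4 : ∫⁻ (x : ({0}ᶜ : Set (EuclideanSpace ℝ (Fin 3)))),
      f ((homeomorphUnitSphereProd (EuclideanSpace ℝ (Fin 3)) x).1) *
      (Set.Iio (⟨1, Set.mem_Ioi.2 one_pos⟩ : Set.Ioi (0 : ℝ))).indicator
      (1 : Set.Ioi (0 : ℝ) → ENNReal) ((homeomorphUnitSphereProd (EuclideanSpace ℝ (Fin 3)) x).2)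
      ∂(Measure.comap Subtype.val volume) =
      ∫⁻ x in ball (0 : EuclideanSpace ℝ (Fin 3)) 1 \ {0}, f (‖x‖⁻¹ • x) := by
    have hset : ball (0 : EuclideanSpace ℝ (Fin 3)) 1 \ {0} =
      ball (0 : EuclideanSpace ℝ (Fin 3)) 1 ∩ {0}ᶜ := rfl
    rw [hset, ← setLIntegral_indicator measurableSet_ball,
      ← lintegral_subtype_comap (measurableSet_singleton _).compl]
    refine lintegral_congr fun x => ?_
    have : (homeomorphUnitSphereProd (EuclideanSpace ℝ (Fin 3)) x).2 ∈
      Set.Iio (⟨1, Set.mem_Ioi.2 one_pos⟩ : Set.Ioi (0 : ℝ)) ↔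
        (x : EuclideanSpace ℝ (Fin 3)) ∈ ball (0 : EuclideanSpace ℝ (Fin 3)) 1 := by
      rw [mem_ball_zero_iff, Set.mem_Iio, ← Subtype.coe_lt_coe, homeomorphUnitSphereProd_apply_snd_coe]
    by_cases hx : (x : EuclideanSpace ℝ (Fin 3)) ∈ ball (0 : EuclideanSpace ℝ (Fin 3)) 1
    · rw [Set.indicator_of_mem hx, Set.indicator_of_mem (this.2 hx)]
      simp
    · rw [Set.indicator_of_notMem hx, Set.indicator_of_notMem (mt this.1 hx), mul_zero]
  rw [← h4, h1, mul_comm, mul_assoc, ENNReal.inv_mul_cancel (by norm_num) (by norm_num), mul_one]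

/-- The homogeneous extension is a norm-preserving bijection of the punctured ball, and its Jacobian
λ² is constant along rays, so the change of variables in the ball descends to the sphere. -/
theorem lintegral_unitSphereMeasure_comp_chordReflection {p : EuclideanSpace ℝ (Fin 3)}
    (hp : ‖p‖ < 1) {f : EuclideanSpace ℝ (Fin 3) → ENNReal} (hf : Measurable f) :
    ∫⁻ u, f u ∂unitSphereMeasure =
      ∫⁻ u, ENNReal.ofReal (chordFactor p (u : EuclideanSpace ℝ (Fin 3)) ^ 2) *
        f (chordReflection p u) ∂unitSphereMeasure := by
  have hm : Measurable (chordReflection p) := by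
    unfold chordReflection
    fun_prop
  have hm' : Measurable (chordFactor p) := by
    unfold chordFactor
    fun_prop
  rw [lintegral_unitSphereMeasure_eq_setLIntegral hf,
    lintegral_unitSphereMeasure_eq_setLIntegral
      (f := fun u => ENNReal.ofReal (chordFactor p u ^ 2) * f (chordReflection p u)) (by fun_prop)]
  set s := ball (0 : EuclideanSpace ℝ (Fin 3)) 1 \ {0} with hs
  have hs0 : ∀ x ∈ s, x ≠ 0 := fun x hx => hx.2
  have hsm : MeasurableSet s := measurableSet_ball.diff (measurableSet_singleton _)
  have hmaps : ∀ x ∈ s, chordReflection p x ∈ s := by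
    intro x hx
    refine ⟨?_, ?_⟩
    · have := hx.1
      rwa [mem_ball_zero_iff, ← norm_chordReflection hp, ← mem_ball_zero_iff] at this
    · have := hx.2
      rwa [Set.mem_singleton_iff, ← norm_eq_zero, norm_chordReflection hp, norm_eq_zero]
  have himg : chordReflection p '' s = s := by
    refine Set.Subset.antisymm (Set.image_subset_iff.2 hmaps) fun x hx => ?_
    exact ⟨_, hmaps x hx, chordReflection_chordReflection hp x⟩
  have hinj : Set.InjOn (chordReflection p) s :=
    (Function.LeftInverse.injective (chordReflection_chordReflection hp)).injOn
  have hex : ∀ x : EuclideanSpace ℝ (Fin 3), ∃ D : EuclideanSpace ℝ (Fin 3) →L[ℝ] EuclideanSpace ℝ (Fin 3),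
      x ∈ s → HasFDerivAt (chordReflection p) D x ∧ |D.det| = chordFactor p x ^ 2 := by
    intro x
    by_cases hx : x ∈ s
    · obtain ⟨D, hD⟩ := exists_hasFDerivAt_chordReflection_det (by simp) hp (hs0 x hx)
      exact ⟨D, fun _ => hD⟩
    · exact ⟨0, fun h => absurd h hx⟩
  choose D hD using hex
  conv_lhs => rw [← himg]
  rw [lintegral_image_eq_lintegral_abs_det_fderiv_mul volume hsm
    (fun x hx => (hD x hx).1.hasFDerivWithinAt) hinj]
  congr 1
  refine setLIntegral_congr_fun hsm fun x hx => ?_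
  have hn : 0 < ‖x‖⁻¹ := inv_pos.2 (norm_pos_iff.2 (hs0 x hx))
  rw [(hD x hx).2, norm_chordReflection hp, chordReflection_smul p x hn, chordFactor_smul p x hn]

end SphereChangeOfVariables

/-! ### The chord involution as the restriction of an inversion. -/

section SphereInvolution

theorem one_sub_norm_sq_pos {E : Type*} [NormedAddCommGroup E] {p : E} (hp : ‖p‖ < 1) :
    0 < 1 - ‖p‖ ^ 2 := by
  nlinarith [norm_nonneg p]

theorem norm_sub_pos_of_norm_lt_one {E : Type*} [NormedAddCommGroup E] {p x : E}
    (hp : ‖p‖ < 1) (hx : 1 ≤ ‖x‖) : 0 < ‖x - p‖ := by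
  refine norm_pos_iff.2 (sub_ne_zero.2 ?_)
  rintro rfl
  linarith

variable {E : Type*} [NormedAddCommGroup E] [InnerProductSpace ℝ E]

/-- The inversion centred at `p` of power `‖p‖ ^ 2 - 1`; it preserves the unit sphere. -/
noncomputable def sphereInvolution (p x : E) : E :=
  p - ((1 - ‖p‖ ^ 2) / ‖x - p‖ ^ 2) • (x - p)

theorem norm_sphereInvolution_sub {p x : E} (hp : ‖p‖ < 1) (hx : 1 ≤ ‖x‖) :
    ‖sphereInvolution p x - p‖ = (1 - ‖p‖ ^ 2) / ‖x - p‖ := by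
  have h1 := one_sub_norm_sq_pos hp
  have h2 := norm_sub_pos_of_norm_lt_one hp hx
  rw [sphereInvolution, sub_sub_cancel_left, norm_neg, norm_smul, Real.norm_of_nonneg (by positivity)]
  field_simp

theorem norm_sphereInvolution_sub_sphereInvolution {p x y : E} (hp : ‖p‖ < 1) (hx : 1 ≤ ‖x‖)
    (hy : 1 ≤ ‖y‖) : ‖sphereInvolution p x - sphereInvolution p y‖ =
      (1 - ‖p‖ ^ 2) / (‖x - p‖ * ‖y - p‖) * ‖x - y‖ := by
  have h1 := one_sub_norm_sq_pos hp
  have h2 := norm_sub_pos_of_norm_lt_one hp hx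
  have h3 := norm_sub_pos_of_norm_lt_one hp hy
  have := dist_div_norm_sq_smul (norm_pos_iff.1 h2) (norm_pos_iff.1 h3) (Real.sqrt (1 - ‖p‖ ^ 2))
  rw [div_pow, div_pow, Real.sq_sqrt h1.le, dist_eq_norm, dist_eq_norm, sub_sub_sub_cancel_right]
    at this
  rw [← this, sphereInvolution, sphereInvolution, sub_sub_sub_cancel_left, norm_sub_rev]

/-- Writing T for the inversion, 1 - |Tx|² = (1 - |p|²)(|x|² - 1)/|x - p|². -/
theorem norm_sphereInvolution_le {p x : E} (hp : ‖p‖ < 1) (hx : 1 ≤ ‖x‖) :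
    ‖sphereInvolution p x‖ ≤ 1 := by
  have h1 := one_sub_norm_sq_pos hp
  have h2 := norm_sub_pos_of_norm_lt_one hp hx
  have h3 : ‖x‖ ^ 2 = ‖x - p‖ ^ 2 + 2 * inner ℝ p (x - p) + ‖p‖ ^ 2 := by
    conv_lhs => rw [← sub_add_cancel x p, norm_add_sq_real, real_inner_comm]
  have h4 : ‖sphereInvolution p x‖ ^ 2 ≤ 1 := by
    rw [sphereInvolution, norm_sub_sq_real, inner_smul_right, norm_smul,
      Real.norm_of_nonneg (by positivity)]
    have : ‖p‖ ^ 2 - 2 * ((1 - ‖p‖ ^ 2) / ‖x - p‖ ^ 2 * inner ℝ p (x - p)) +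
      ((1 - ‖p‖ ^ 2) / ‖x - p‖ ^ 2 * ‖x - p‖) ^ 2 = 1 - (1 - ‖p‖ ^ 2) / ‖x - p‖ ^ 2 *
        (‖x‖ ^ 2 - 1) := by
      rw [h3]; field_simp; ring
    rw [this]
    have : 0 ≤ (1 - ‖p‖ ^ 2) / ‖x - p‖ ^ 2 * (‖x‖ ^ 2 - 1) := by
      have : 0 ≤ ‖x‖ ^ 2 - 1 := by nlinarith
      positivity
    linarith
  nlinarith [norm_nonneg (sphereInvolution p x)]

theorem chordFactor_of_norm_eq_one (p : E) {u : E} (hu : ‖u‖ = 1) :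
    chordFactor p u = (1 - ‖p‖ ^ 2) / ‖u - p‖ ^ 2 := by
  rw [chordFactor, hu, one_smul]; simp

theorem chordReflection_of_norm_eq_one {p u : E} (hp : ‖p‖ < 1) (hu : ‖u‖ = 1) :
    chordReflection p u = sphereInvolution p u := by
  have h2 := norm_sub_pos_of_norm_lt_one hp hu.ge
  have h3 : 2 * inner ℝ u (u - p) / ‖u - p‖ ^ 2 = 1 + (1 - ‖p‖ ^ 2) / ‖u - p‖ ^ 2 := by
    have h4 : ‖u - p‖ ^ 2 = 1 - 2 * inner ℝ u p + ‖p‖ ^ 2 := by rw [norm_sub_sq_real, hu]; ring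
    have h5 : inner ℝ u (u - p) = 1 - inner ℝ u p := by
      rw [inner_sub_right, real_inner_self_eq_norm_sq, hu]; ring
    field_simp
    rw [h4, h5]; ring
  rw [chordReflection, sphereInvolution, hu, one_smul, h3]
  module

end SphereInvolution

/-! ### Newton's theorem for the sphere and the sweeping of point charges. -/

section NewtonianPotential

open Metric

local notation "E₃" => EuclideanSpace ℝ (Fin 3)

theorem lintegral_unitSphereMeasure_comp_sphereInvolution {p : E₃} (hp : ‖p‖ < 1)
    {f : E₃ → ENNReal} (hf : Measurable f) :
    ∫⁻ u, f u ∂unitSphereMeasure =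
      ∫⁻ u, ENNReal.ofReal (((1 - ‖p‖ ^ 2) / ‖(u : E₃) - p‖ ^ 2) ^ 2) *
        f (sphereInvolution p u) ∂unitSphereMeasure := by
  rw [lintegral_unitSphereMeasure_comp_chordReflection hp hf]
  refine lintegral_congr fun u => ?_
  have hu : ‖(u : E₃)‖ = 1 := by simp
  rw [chordFactor_of_norm_eq_one p hu, chordReflection_of_norm_eq_one hp hu]

theorem unitSphereMeasure_univ : unitSphereMeasure Set.univ = ENNReal.ofReal (4 * Real.pi) := by
  rw [unitSphereMeasure, Measure.toSphere_apply_univ, EuclideanSpace.volume_ball_fin_three]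
  simp only [finrank_euclideanSpace, Fintype.card_fin]
  rw [ENNReal.ofReal_one, one_pow, one_mul]
  rw [← ENNReal.ofReal_natCast, ← ENNReal.ofReal_mul (by positivity)]
  congr 1
  push_cast; ring

/-- With κ = 1 - |p|², the inversion turns 1/|u - p| into |u - p|/κ, and its Jacobian is κ²/|u -
p|⁴. -/
theorem lintegral_inv_norm_sub_eq_poisson {p : E₃} (hp : ‖p‖ < 1) :
    ∫⁻ u, ENNReal.ofReal (1 / ‖(u : E₃) - p‖) ∂unitSphereMeasure =
      ∫⁻ u, ENNReal.ofReal ((1 - ‖p‖ ^ 2) / ‖(u : E₃) - p‖ ^ 3) ∂unitSphereMeasure := by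
  rw [lintegral_unitSphereMeasure_comp_sphereInvolution hp
    (f := fun x => ENNReal.ofReal (1 / ‖x - p‖)) (by fun_prop)]
  refine lintegral_congr fun u => ?_
  have hu : ‖(u : E₃)‖ = 1 := by simp
  have h1 := one_sub_norm_sq_pos hp
  have h2 := norm_sub_pos_of_norm_lt_one hp hu.ge
  rw [norm_sphereInvolution_sub hp hu.ge, ← ENNReal.ofReal_mul (by positivity)]
  congr 1
  field_simp

end NewtonianPotential

section NewtonianPotential

open Metric

local notation "E₃" => EuclideanSpace ℝ (Fin 3)

theorem integrable_unitSphereMeasure {f : sphere (0 : E₃) 1 → ℝ} (hf : Continuous f) :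
    Integrable f unitSphereMeasure :=
  hf.integrable_of_hasCompactSupport (HasCompactSupport.of_compactSpace _)

theorem continuous_inv_norm_sub {p : E₃} (hp : ‖p‖ < 1) :
    Continuous fun u : sphere (0 : E₃) 1 => 1 / ‖(u : E₃) - p‖ := by
  refine continuous_const.div (by fun_prop) fun u => ?_
  exact (norm_sub_pos_of_norm_lt_one hp (by simp)).ne'

theorem hasDerivAt_inv_norm_sub_smul {u p : E₃} {s : ℝ} (h : u - s • p ≠ 0) :
    HasDerivAt (fun s : ℝ => 1 / ‖u - s • p‖) (inner ℝ (u - s • p) p / ‖u - s • p‖ ^ 3) s := by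
  have h0 : ‖u - s • p‖ ≠ 0 := norm_ne_zero_iff.2 h
  have h1 : HasDerivAt (fun s : ℝ => u - s • p) (-((1 : ℝ) • p)) s :=
    ((hasDerivAt_id s).smul_const p).const_sub u
  have h2 := (h1.norm_sq.sqrt (by positivity)).fun_inv (by positivity)
  simp only [Real.sqrt_sq (norm_nonneg _)] at h2
  simp only [one_div]
  refine h2.congr_deriv ?_
  rw [one_smul, inner_neg_right]
  field_simp

theorem hasDerivAt_integral_inv_norm_sub_smul {p : E₃} {s : ℝ} (h : ‖s • p‖ < 1) :
    HasDerivAt (fun s : ℝ => ∫ u, 1 / ‖(u : E₃) - s • p‖ ∂unitSphereMeasure)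
      (∫ u, inner ℝ ((u : E₃) - s • p) p / ‖(u : E₃) - s • p‖ ^ 3 ∂unitSphereMeasure) s := by
  -- The margin 1 - ρ bounds the distance to the sphere from below near `s`, which dominates the
  -- derivative of the integrand.
  obtain ⟨ρ, hρ1, hρ2⟩ := exists_between h
  have hmem : {t : ℝ | ‖t • p‖ < ρ} ∈ nhds s :=
    (isOpen_lt (by fun_prop) continuous_const).mem_nhds hρ1
  have hlow : ∀ t ∈ {t : ℝ | ‖t • p‖ < ρ}, ∀ u : sphere (0 : E₃) 1, 1 - ρ ≤ ‖(u : E₃) - t • p‖ := by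
    intro t ht u
    have h1 := norm_sub_norm_le (u : E₃) (t • p)
    have h2 : ‖(u : E₃)‖ = 1 := by simp
    have h3 : ‖t • p‖ < ρ := ht
    linarith
  have hρ : 0 < 1 - ρ := by linarith
  have hmeas : ∀ t : ℝ, AEStronglyMeasurable (fun u : sphere (0 : E₃) 1 => 1 / ‖(u : E₃) - t • p‖)
      unitSphereMeasure := fun t => by
    refine Measurable.aestronglyMeasurable ?_
    fun_prop
  refine (hasDerivAt_integral_of_dominated_loc_of_deriv_le (μ := unitSphereMeasure)
    (F := fun (t : ℝ) (u : sphere (0 : E₃) 1) => 1 / ‖(u : E₃) - t • p‖)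
    (F' := fun (t : ℝ) (u : sphere (0 : E₃) 1) =>
      inner ℝ ((u : E₃) - t • p) p / ‖(u : E₃) - t • p‖ ^ 3)
    (bound := fun _ => ‖p‖ / (1 - ρ) ^ 2) hmem (.of_forall hmeas)
    (integrable_unitSphereMeasure (continuous_inv_norm_sub h)) ?_ ?_ (integrable_const _) ?_).2
  · refine Measurable.aestronglyMeasurable ?_
    fun_prop
  · refine .of_forall fun u t ht => ?_
    have h1 := hlow t ht u
    have h2 : 0 < ‖(u : E₃) - t • p‖ := hρ.trans_le h1
    rw [norm_div, norm_pow, norm_norm, div_le_div_iff₀ (by positivity) (by positivity)]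
    calc ‖inner ℝ ((u : E₃) - t • p) p‖ * (1 - ρ) ^ 2
        ≤ (‖(u : E₃) - t • p‖ * ‖p‖) * ‖(u : E₃) - t • p‖ ^ 2 := by
          gcongr
          exact norm_inner_le_norm _ _
      _ = _ := by ring
  · refine .of_forall fun u t ht => hasDerivAt_inv_norm_sub_smul ?_
    exact norm_pos_iff.1 (hρ.trans_le (hlow t ht u))

theorem integral_inv_norm_sub_eq_poisson {p : E₃} (hp : ‖p‖ < 1) :
    ∫ u, 1 / ‖(u : E₃) - p‖ ∂unitSphereMeasure =
      ∫ u, (1 - ‖p‖ ^ 2) / ‖(u : E₃) - p‖ ^ 3 ∂unitSphereMeasure := by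
  have := one_sub_norm_sq_pos hp
  rw [integral_eq_lintegral_of_nonneg_ae, integral_eq_lintegral_of_nonneg_ae,
    lintegral_inv_norm_sub_eq_poisson hp]
  · exact .of_forall fun u => by positivity
  · refine Measurable.aestronglyMeasurable ?_
    fun_prop
  · exact .of_forall fun u => by positivity
  · refine Measurable.aestronglyMeasurable ?_
    fun_prop

/-- Since 2⟨u - sp, sp⟩ = 1 - |sp|² - |u - sp|² on the sphere, the integrand is (2s)⁻¹ times the
difference of the two integrands in `integral_inv_norm_sub_eq_poisson`. -/
theorem integral_inner_div_norm_sub_cube {p : E₃} {s : ℝ} (hs : s ≠ 0) (h : ‖s • p‖ < 1) :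
    ∫ u, inner ℝ ((u : E₃) - s • p) p / ‖(u : E₃) - s • p‖ ^ 3 ∂unitSphereMeasure = 0 := by
  have hpos : ∀ u : sphere (0 : E₃) 1, 0 < ‖(u : E₃) - s • p‖ := fun u =>
    norm_sub_pos_of_norm_lt_one h (by simp)
  have h1 : ∀ u : sphere (0 : E₃) 1, inner ℝ ((u : E₃) - s • p) p / ‖(u : E₃) - s • p‖ ^ 3 =
      (2 * s)⁻¹ * ((1 - ‖s • p‖ ^ 2) / ‖(u : E₃) - s • p‖ ^ 3 - 1 / ‖(u : E₃) - s • p‖) := by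
    intro u
    have h2 : ‖(u : E₃)‖ ^ 2 = ‖(u : E₃) - s • p‖ ^ 2 +
        2 * (s * inner ℝ ((u : E₃) - s • p) p) + ‖s • p‖ ^ 2 := by
      conv_lhs => rw [← sub_add_cancel (u : E₃) (s • p), norm_add_sq_real, inner_smul_right]
    have h3 : ‖(u : E₃)‖ = 1 := by simp
    have h4 := (hpos u).ne'
    have h5 : inner ℝ ((u : E₃) - s • p) p =
      (1 - ‖s • p‖ ^ 2 - ‖(u : E₃) - s • p‖ ^ 2) / (2 * s) := by
      rw [h3] at h2
      field_simp
      linarith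
    rw [h5]
    field_simp
  simp_rw [h1]
  rw [integral_const_mul, integral_sub, integral_inv_norm_sub_eq_poisson h, sub_self, mul_zero]
  · refine integrable_unitSphereMeasure (continuous_const.div (by fun_prop) fun u => ?_)
    have := hpos u
    positivity
  · exact integrable_unitSphereMeasure (continuous_inv_norm_sub h)

/-- The potential along the segment from 0 to `p` has zero derivative in the open segment, so the
mean value theorem carries the value 4π from the centre to `p`. -/
theorem integral_inv_norm_sub {p : E₃} (hp : ‖p‖ < 1) :
    ∫ u, 1 / ‖(u : E₃) - p‖ ∂unitSphereMeasure = 4 * Real.pi := by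
  have hlt : ∀ s ∈ Set.Icc (0 : ℝ) 1, ‖s • p‖ < 1 := by
    intro s hs
    rw [norm_smul, Real.norm_of_nonneg hs.1]
    nlinarith [hs.1, hs.2, norm_nonneg p]
  obtain ⟨s, hs, h⟩ := exists_hasDerivAt_eq_slope
    (fun s : ℝ => ∫ u, 1 / ‖(u : E₃) - s • p‖ ∂unitSphereMeasure) _ one_pos
    (fun s hs => (hasDerivAt_integral_inv_norm_sub_smul (hlt s hs)).continuousAt.continuousWithinAt)
    (fun s hs => hasDerivAt_integral_inv_norm_sub_smul (hlt s (Set.Ioo_subset_Icc_self hs)))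
  rw [integral_inner_div_norm_sub_cube hs.1.ne' (hlt s (Set.Ioo_subset_Icc_self hs))] at h
  have h0 : ∀ u : sphere (0 : E₃) 1, ‖(u : E₃)‖ = 1 := fun u => by simp
  simp only [one_smul, zero_smul, sub_zero, h0, div_one, integral_const, smul_eq_mul, mul_one,
    measureReal_def, unitSphereMeasure_univ] at h
  rw [ENNReal.toReal_ofReal (by positivity)] at h
  linarith

theorem lintegral_inv_norm_sub_of_norm_lt_one {p : E₃} (hp : ‖p‖ < 1) :
    ∫⁻ u, ENNReal.ofReal (1 / ‖(u : E₃) - p‖) ∂unitSphereMeasure = ENNReal.ofReal (4 * Real.pi) := by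
  rw [← integral_inv_norm_sub hp, ofReal_integral_eq_lintegral_ofReal
    (integrable_unitSphereMeasure (continuous_inv_norm_sub hp)) (.of_forall fun u => by positivity)]

theorem norm_sub_smul_div_sqrt {u x : E₃} (hu : ‖u‖ = 1) (hx : ‖x‖ = 1) {s : ℝ} (hs : 0 < s) :
    ‖u - s • x‖ / Real.sqrt s = Real.sqrt (s + s⁻¹ - 2 * inner ℝ u x) := by
  rw [eq_comm, Real.sqrt_eq_iff_eq_sq _ (by positivity), div_pow, Real.sq_sqrt hs.le,
    norm_sub_sq_real, norm_smul, hu, hx, inner_smul_right, Real.norm_of_nonneg hs.le]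
  · field_simp
    ring
  · have h1 : inner ℝ u x ≤ 1 := by
      have := real_inner_le_norm u x
      rwa [hu, hx, one_mul] at this
    have h2 : s + s⁻¹ - 2 = (s - 1) ^ 2 / s := by field_simp; ring
    have h3 : 0 ≤ (s - 1) ^ 2 / s := by positivity
    linarith

/-- For |x| = 1, interior points sx with s ↑ 1 are used. After normalisation, |u - sx|²/s = s + 1/s
- 2⟨u, x⟩ decreases in s, so monotone convergence applies. The inverse in `ENNReal` is ∞ at u = x,
as monotonicity requires. -/
theorem lintegral_inv_norm_sub_of_norm_le_one {x : E₃} (hx : ‖x‖ ≤ 1) :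
    ∫⁻ u, (ENNReal.ofReal ‖(u : E₃) - x‖)⁻¹ ∂unitSphereMeasure = ENNReal.ofReal (4 * Real.pi) := by
  rcases hx.lt_or_eq with hx | hx
  · rw [← lintegral_inv_norm_sub_of_norm_lt_one hx]
    refine lintegral_congr fun u => ?_
    rw [one_div, ENNReal.ofReal_inv_of_pos (norm_sub_pos_of_norm_lt_one hx (by simp))]
  obtain ⟨s, hmono, hlt, hlim⟩ := exists_seq_strictMono_tendsto' (show (0 : ℝ) < 1 from one_pos)
  have hs0 : ∀ n, 0 < Real.sqrt (s n) := fun n => Real.sqrt_pos.2 (hlt n).1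
  have hsx : ∀ n, ‖s n • x‖ < 1 := fun n => by
    rw [norm_smul, hx, mul_one, Real.norm_of_nonneg (hlt n).1.le]; exact (hlt n).2
  have h1 := lintegral_tendsto_of_tendsto_of_monotone (μ := unitSphereMeasure)
    (f := fun n (u : sphere (0 : E₃) 1) =>
      (ENNReal.ofReal (‖(u : E₃) - s n • x‖ / Real.sqrt (s n)))⁻¹)
    (F := fun u => (ENNReal.ofReal ‖(u : E₃) - x‖)⁻¹) (fun n => by fun_prop) ?_ ?_
  · refine tendsto_nhds_unique h1 ?_
    have h2 : ∀ n, ∫⁻ u, (ENNReal.ofReal (‖(u : E₃) - s n • x‖ / Real.sqrt (s n)))⁻¹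
        ∂unitSphereMeasure = ENNReal.ofReal (Real.sqrt (s n) * (4 * Real.pi)) := by
      intro n
      rw [ENNReal.ofReal_mul (hs0 n).le, ← lintegral_inv_norm_sub_of_norm_lt_one (hsx n),
        ← lintegral_const_mul _ (by fun_prop)]
      refine lintegral_congr fun u => ?_
      have := norm_sub_pos_of_norm_lt_one (hsx n) (x := (u : E₃)) (by simp)
      rw [← ENNReal.ofReal_inv_of_pos (div_pos this (hs0 n)), ← ENNReal.ofReal_mul (hs0 n).le]
      congr 1
      field_simp
    simp only [h2]
    have h3 : Filter.Tendsto (fun n => Real.sqrt (s n) * (4 * Real.pi)) Filter.atTop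
        (nhds (Real.sqrt 1 * (4 * Real.pi))) := (hlim.sqrt).mul_const _
    rw [Real.sqrt_one, one_mul] at h3
    exact ENNReal.tendsto_ofReal h3
  · refine .of_forall fun u m n hmn => ?_
    have hu : ‖(u : E₃)‖ = 1 := by simp
    simp only
    rw [norm_sub_smul_div_sqrt hu hx (hlt m).1, norm_sub_smul_div_sqrt hu hx (hlt n).1,
      ENNReal.inv_le_inv]
    refine ENNReal.ofReal_le_ofReal (Real.sqrt_le_sqrt ?_)
    have hle := hmono.monotone hmn
    have h2 : s m + (s m)⁻¹ - (s n + (s n)⁻¹) = (s n - s m) * (1 - s m * s n) / (s m * s n) := by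
      have := (hlt m).1.ne'
      have := (hlt n).1.ne'
      field_simp
      ring
    have h3 : 0 ≤ (s n - s m) * (1 - s m * s n) / (s m * s n) := by
      have h4 : 0 ≤ 1 - s m * s n := by nlinarith [(hlt m).1, (hlt m).2, (hlt n).1, (hlt n).2]
      have := (hlt m).1
      have := (hlt n).1
      have : 0 ≤ s n - s m := by linarith
      positivity
    linarith
  · refine .of_forall fun u => ?_
    refine Filter.Tendsto.inv (ENNReal.tendsto_ofReal ?_)
    have h3 : Filter.Tendsto (fun n => ‖(u : E₃) - s n • x‖ / Real.sqrt (s n)) Filter.atTop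
        (nhds (‖(u : E₃) - (1 : ℝ) • x‖ / Real.sqrt 1)) :=
      (tendsto_const_nhds.sub (hlim.smul_const x)).norm.div hlim.sqrt (by simp)
    simpa using h3

/-- Under the inversion T, Poisson kernel times Jacobian becomes 1/|u - p|, while |x - Tu| = |x - p|
|u - Tx| / |u - p|. The integrand is then 1/(|x - p| |u - Tx|), and Newton's theorem applies because
|Tx| ≤ 1. -/
theorem lintegral_poisson_mul_inv_norm_sub {p x : E₃} (hp : ‖p‖ < 1) (hx : 1 ≤ ‖x‖) :
    ∫⁻ u, ENNReal.ofReal ((1 - ‖p‖ ^ 2) / ‖(u : E₃) - p‖ ^ 3) * (ENNReal.ofReal ‖x - u‖)⁻¹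
      ∂unitSphereMeasure = ENNReal.ofReal (4 * Real.pi / ‖x - p‖) := by
  have hk := one_sub_norm_sq_pos hp
  have hxp := norm_sub_pos_of_norm_lt_one hp hx
  rw [lintegral_unitSphereMeasure_comp_sphereInvolution hp
    (f := fun y => ENNReal.ofReal ((1 - ‖p‖ ^ 2) / ‖y - p‖ ^ 3) * (ENNReal.ofReal ‖x - y‖)⁻¹)
    (by fun_prop), div_eq_inv_mul, ENNReal.ofReal_mul (by positivity),
    ← lintegral_inv_norm_sub_of_norm_le_one (norm_sphereInvolution_le hp hx),
    ← lintegral_const_mul _ (by fun_prop)]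
  refine lintegral_congr fun u => ?_
  have hu : ‖(u : E₃)‖ = 1 := by simp
  have hup := norm_sub_pos_of_norm_lt_one hp hu.ge
  have hTu : ‖sphereInvolution p (u : E₃)‖ = 1 := by
    rw [← chordReflection_of_norm_eq_one hp hu, norm_chordReflection hp, hu]
  have hTT : sphereInvolution p (sphereInvolution p (u : E₃)) = u := by
    rw [← chordReflection_of_norm_eq_one hp hTu, ← chordReflection_of_norm_eq_one hp hu,
      chordReflection_chordReflection hp]
  have hdist := norm_sphereInvolution_sub_sphereInvolution hp hTu.ge hx
  rw [hTT, norm_sphereInvolution_sub hp hu.ge] at hdist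
  have h1 : ‖x - sphereInvolution p (u : E₃)‖ =
      ‖x - p‖ / ‖(u : E₃) - p‖ * ‖(u : E₃) - sphereInvolution p x‖ := by
    rw [hdist, norm_sub_rev x]
    field_simp
  rw [h1, norm_sphereInvolution_sub hp hu.ge, ENNReal.ofReal_mul (by positivity),
    ENNReal.mul_inv (.inr ENNReal.ofReal_ne_top) (.inl ENNReal.ofReal_ne_top), ← mul_assoc,
    ← mul_assoc, ← ENNReal.ofReal_inv_of_pos (by positivity), ← ENNReal.ofReal_mul (by positivity),
    ← ENNReal.ofReal_mul (by positivity)]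
  congr 2
  field_simp

theorem lintegral_poisson {p : E₃} (hp : ‖p‖ < 1) :
    ∫⁻ u, ENNReal.ofReal ((1 - ‖p‖ ^ 2) / ‖(u : E₃) - p‖ ^ 3) ∂unitSphereMeasure =
      ENNReal.ofReal (4 * Real.pi) := by
  rw [← lintegral_inv_norm_sub_eq_poisson hp, lintegral_inv_norm_sub_of_norm_lt_one hp]

end NewtonianPotential

/-! ### Poisson densities on an arbitrary sphere. -/

section PoissonDensity

open Metric

local notation "E₃" => EuclideanSpace ℝ (Fin 3)

theorem lintegral_sphereMeasure (c : E₃) (r : ℝ) {f : E₃ → ENNReal} (hf : Measurable f) :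
    ∫⁻ y, f y ∂sphereMeasure c r =
      ENNReal.ofReal (r ^ 2) * ∫⁻ u, f (c + r • (u : E₃)) ∂unitSphereMeasure := by
  rw [sphereMeasure, lintegral_smul_measure, lintegral_map hf (by fun_prop), smul_eq_mul]

instance isFiniteMeasure_sphereMeasure (c : E₃) (r : ℝ) : IsFiniteMeasure (sphereMeasure c r) := by
  unfold sphereMeasure
  have : IsFiniteMeasure ((volume : Measure E₃).toSphere.map
      (fun u : Metric.sphere (0 : E₃) 1 => c + r • (u : E₃))) := inferInstance
  exact Measure.smul_finite _ ENNReal.ofReal_ne_top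

instance isFiniteMeasure_boundaryMeasure (c : Fin 2 → E₃) (r : Fin 2 → ℝ) :
    IsFiniteMeasure (boundaryMeasure c r) := by
  rw [boundaryMeasure, Fin.sum_univ_two]
  infer_instance

theorem ae_mem_sphere {c : E₃} {r : ℝ} (hr : 0 < r) :
    ∀ᵐ y ∂sphereMeasure c r, y ∈ sphere c r := by
  refine Measure.ae_smul_measure ?_ _
  refine (ae_map_iff (p := fun y => y ∈ sphere c r) (by fun_prop)
    isClosed_sphere.measurableSet).2 (.of_forall fun u => ?_)
  simp [norm_smul, abs_of_pos hr]

/-- The density on the sphere `sphere c r` obtained by sweeping a unit point charge at the interior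
point `a` onto the sphere (and zero away from the sphere). -/
noncomputable def poissonDensity (c : E₃) (r : ℝ) (a : E₃) : E₃ → ℝ :=
  (sphere c r).indicator fun y => (r ^ 2 - ‖a - c‖ ^ 2) / (4 * Real.pi * r * ‖y - a‖ ^ 3)

theorem measurable_poissonDensity (c : E₃) (r : ℝ) (a : E₃) : Measurable (poissonDensity c r a) := by
  refine Measurable.indicator ?_ isClosed_sphere.measurableSet
  fun_prop

theorem poissonDensity_nonneg {c : E₃} {r : ℝ} (hr : 0 < r) {a : E₃} (ha : ‖a - c‖ ≤ r) (y : E₃) :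
    0 ≤ poissonDensity c r a y := by
  refine Set.indicator_nonneg (fun y _ => ?_) y
  have : 0 ≤ r ^ 2 - ‖a - c‖ ^ 2 := by nlinarith [norm_nonneg (a - c)]
  positivity

theorem poissonDensity_le {c : E₃} {r δ : ℝ} (hr : 0 < r) (hδ : 0 < δ) {a : E₃}
    (ha : ‖a - c‖ ≤ r - δ) (y : E₃) :
    poissonDensity c r a y ≤ r ^ 2 / (4 * Real.pi * r * δ ^ 3) := by
  refine Set.indicator_apply_le' (fun hy => ?_) (fun _ => by positivity)
  have h1 : δ ≤ ‖y - a‖ := by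
    have h2 := norm_sub_norm_le (y - c) (a - c)
    rw [sub_sub_sub_cancel_right, mem_sphere_iff_norm.1 hy] at h2
    linarith
  gcongr
  nlinarith [norm_nonneg (a - c)]

theorem ofReal_poissonDensity {c : E₃} {r : ℝ} (hr : 0 < r) (a : E₃) {u : E₃} (hu : ‖u‖ = 1) :
    ENNReal.ofReal (poissonDensity c r a (c + r • u)) = ENNReal.ofReal (4 * Real.pi * r ^ 2)⁻¹ *
      ENNReal.ofReal ((1 - ‖r⁻¹ • (a - c)‖ ^ 2) / ‖u - r⁻¹ • (a - c)‖ ^ 3) := by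
  have hmem : c + r • u ∈ sphere c r := by simp [norm_smul, hu, abs_of_pos hr]
  have h1 : c + r • u - a = r • (u - r⁻¹ • (a - c)) := by
    rw [smul_sub, smul_inv_smul₀ hr.ne']; abel
  have h2 : ‖a - c‖ = r * ‖r⁻¹ • (a - c)‖ := by
    rw [norm_smul, norm_inv, Real.norm_of_nonneg hr.le, mul_inv_cancel_left₀ hr.ne']
  rw [poissonDensity, Set.indicator_of_mem hmem, ← ENNReal.ofReal_mul (by positivity), h1, norm_smul,
    Real.norm_of_nonneg hr.le]
  conv_lhs => rw [h2]
  congr 1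
  by_cases h0 : ‖u - r⁻¹ • (a - c)‖ = 0
  · simp [h0]
  field_simp

theorem norm_inv_smul_sub_lt_one {c : E₃} {r : ℝ} (hr : 0 < r) {a : E₃} (ha : ‖a - c‖ < r) :
    ‖r⁻¹ • (a - c)‖ < 1 := by
  rw [norm_smul, norm_inv, Real.norm_of_nonneg hr.le, inv_mul_lt_iff₀ hr, mul_one]
  exact ha

theorem lintegral_poissonDensity {c : E₃} {r : ℝ} (hr : 0 < r) {a : E₃} (ha : ‖a - c‖ < r) :
    ∫⁻ y, ENNReal.ofReal (poissonDensity c r a y) ∂sphereMeasure c r = 1 := by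
  have hm := measurable_poissonDensity c r a
  rw [lintegral_sphereMeasure c r (by fun_prop)]
  have : ∀ u : sphere (0 : E₃) 1, ‖(u : E₃)‖ = 1 := fun u => by simp
  simp_rw [fun u : sphere (0 : E₃) 1 => ofReal_poissonDensity (c := c) hr a (this u)]
  rw [lintegral_const_mul _ (by fun_prop), lintegral_poisson (norm_inv_smul_sub_lt_one hr ha),
    ← ENNReal.ofReal_mul (by positivity), ← ENNReal.ofReal_mul (by positivity), ← ENNReal.ofReal_one]
  congr 1
  have := Real.pi_pos
  field_simp

theorem lintegral_poissonDensity_mul_inv_norm_sub {c : E₃} {r : ℝ} (hr : 0 < r) {a x : E₃}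
    (ha : ‖a - c‖ < r) (hx : r ≤ ‖x - c‖) :
    ∫⁻ y, ENNReal.ofReal (poissonDensity c r a y) * (ENNReal.ofReal ‖x - y‖)⁻¹ ∂sphereMeasure c r =
      ENNReal.ofReal (1 / ‖x - a‖) := by
  have hm := measurable_poissonDensity c r a
  rw [lintegral_sphereMeasure c r (by fun_prop)]
  have hu : ∀ u : sphere (0 : E₃) 1, ‖(u : E₃)‖ = 1 := fun u => by simp
  have h1 : ∀ z : E₃, ‖z‖ = r * ‖r⁻¹ • z‖ := fun z => by
    rw [norm_smul, norm_inv, Real.norm_of_nonneg hr.le, mul_inv_cancel_left₀ hr.ne']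
  have hX : 1 ≤ ‖r⁻¹ • (x - c)‖ := by
    rw [h1] at hx
    nlinarith
  have h2 : ∀ u : sphere (0 : E₃) 1, (ENNReal.ofReal ‖x - (c + r • (u : E₃))‖)⁻¹ =
      ENNReal.ofReal r⁻¹ * (ENNReal.ofReal ‖r⁻¹ • (x - c) - u‖)⁻¹ := by
    intro u
    have h3 : r⁻¹ • (x - (c + r • (u : E₃))) = r⁻¹ • (x - c) - u := by
      rw [← sub_sub, smul_sub _ (x - c), inv_smul_smul₀ hr.ne']
    rw [h1, h3, ENNReal.ofReal_mul hr.le, ENNReal.mul_inv (.inr ENNReal.ofReal_ne_top)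
      (.inl ENNReal.ofReal_ne_top), ENNReal.ofReal_inv_of_pos hr]
  have h4 : ‖x - a‖ = r * ‖r⁻¹ • (x - c) - r⁻¹ • (a - c)‖ := by
    rw [h1, ← smul_sub, sub_sub_sub_cancel_right]
  have h5 := norm_sub_pos_of_norm_lt_one (norm_inv_smul_sub_lt_one hr ha) hX
  simp_rw [fun u : sphere (0 : E₃) 1 => ofReal_poissonDensity (c := c) hr a (hu u), h2,
    mul_mul_mul_comm _ _ (ENNReal.ofReal r⁻¹)]
  rw [lintegral_const_mul _ (by fun_prop), lintegral_poisson_mul_inv_norm_sub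
    (norm_inv_smul_sub_lt_one hr ha) hX, ← ENNReal.ofReal_mul (by positivity),
    ← ENNReal.ofReal_mul (by positivity), ← ENNReal.ofReal_mul (by positivity), h4]
  congr 1
  have := Real.pi_pos
  field_simp

theorem integral_poissonDensity {c : E₃} {r : ℝ} (hr : 0 < r) {a : E₃} (ha : ‖a - c‖ < r) :
    ∫ y, poissonDensity c r a y ∂sphereMeasure c r = 1 := by
  rw [integral_eq_lintegral_of_nonneg_ae (.of_forall (poissonDensity_nonneg hr ha.le))
    (measurable_poissonDensity c r a).aestronglyMeasurable, lintegral_poissonDensity hr ha,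
    ENNReal.toReal_one]

/-- Real division gives 0 at y = x where the `ENNReal` inverse gives ∞. The integral is finite and
the density is positive on the sphere, so the two integrands agree almost everywhere. -/
theorem lintegral_poissonDensity_div_norm_sub {c : E₃} {r : ℝ} (hr : 0 < r) {a x : E₃}
    (ha : ‖a - c‖ < r) (hx : r ≤ ‖x - c‖) :
    ∫⁻ y, ENNReal.ofReal (poissonDensity c r a y / ‖x - y‖) ∂sphereMeasure c r =
      ENNReal.ofReal (1 / ‖x - a‖) := by
  have hm := measurable_poissonDensity c r a
  have h := lintegral_poissonDensity_mul_inv_norm_sub hr ha hx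
  rw [← h]
  have hfin := ae_lt_top (μ := sphereMeasure c r) (f := fun y =>
    ENNReal.ofReal (poissonDensity c r a y) * (ENNReal.ofReal ‖x - y‖)⁻¹) (by fun_prop)
    (by rw [h]; exact ENNReal.ofReal_ne_top)
  refine lintegral_congr_ae ?_
  filter_upwards [hfin, ae_mem_sphere hr] with y hy hys
  have hpos : 0 < poissonDensity c r a y := by
    rw [poissonDensity, Set.indicator_of_mem hys]
    have h1 : y - a ≠ 0 := by
      rw [sub_ne_zero]
      rintro rfl
      exact ha.ne (mem_sphere_iff_norm.1 hys)
    have h2 : 0 < r ^ 2 - ‖a - c‖ ^ 2 := by nlinarith [norm_nonneg (a - c)]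
    positivity
  have hxy : 0 < ‖x - y‖ := by
    by_contra hxy
    have h0 : ENNReal.ofReal ‖x - y‖ = 0 := ENNReal.ofReal_of_nonpos (not_lt.1 hxy)
    rw [h0, ENNReal.inv_zero, ENNReal.mul_top (by simpa using hpos)] at hy
    exact hy.ne rfl
  rw [← ENNReal.ofReal_inv_of_pos hxy, ← ENNReal.ofReal_mul hpos.le, div_eq_mul_inv]

theorem integral_poissonDensity_div_norm_sub {c : E₃} {r : ℝ} (hr : 0 < r) {a x : E₃}
    (ha : ‖a - c‖ < r) (hx : r ≤ ‖x - c‖) :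
    Integrable (fun y => poissonDensity c r a y / ‖x - y‖) (sphereMeasure c r) ∧
      ∫ y, poissonDensity c r a y / ‖x - y‖ ∂sphereMeasure c r = 1 / ‖x - a‖ := by
  have h := lintegral_poissonDensity_div_norm_sub hr ha hx
  have hm := measurable_poissonDensity c r a
  have hnn : ∀ y, 0 ≤ poissonDensity c r a y / ‖x - y‖ := fun y =>
    div_nonneg (poissonDensity_nonneg hr ha.le y) (norm_nonneg _)
  have hms : AEStronglyMeasurable (fun y => poissonDensity c r a y / ‖x - y‖)
      (sphereMeasure c r) := by
    refine Measurable.aestronglyMeasurable ?_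
    fun_prop
  refine ⟨⟨hms, ?_⟩, ?_⟩
  · rw [hasFiniteIntegral_iff_ofReal (.of_forall hnn), h]
    exact ENNReal.ofReal_lt_top
  · rw [integral_eq_lintegral_of_nonneg_ae (.of_forall hnn) hms, h,
      ENNReal.toReal_ofReal (by positivity)]

end PoissonDensity

/-! ### Sweeping a summable sequence of charges. -/

section SweptCharges

open Metric

local notation "E₃" => EuclideanSpace ℝ (Fin 3)

/-- The charge at the centre sweeps to the uniform density 1/(4πr²). -/
theorem integral_inv_norm_sub_sphereMeasure {c : E₃} {r : ℝ} (hr : 0 < r) {x : E₃}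
    (hx : r ≤ ‖x - c‖) :
    Integrable (fun y => 1 / ‖x - y‖) (sphereMeasure c r) ∧
      ∫ y, 1 / ‖x - y‖ ∂sphereMeasure c r = 4 * Real.pi * r ^ 2 / ‖x - c‖ := by
  obtain ⟨h1, h2⟩ := integral_poissonDensity_div_norm_sub hr (a := c) (by simpa using hr) hx
  have hpi := Real.pi_pos
  have h3 : (fun y => 1 / ‖x - y‖) =ᵐ[sphereMeasure c r]
      fun y => 4 * Real.pi * r ^ 2 * (poissonDensity c r c y / ‖x - y‖) := by
    filter_upwards [ae_mem_sphere hr] with y hy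
    rw [poissonDensity, Set.indicator_of_mem hy, mem_sphere_iff_norm.1 hy]
    simp only [sub_self, norm_zero]
    field_simp
    simp
  refine ⟨(h1.const_mul _).congr h3.symm, ?_⟩
  rw [integral_congr_ae h3, integral_const_mul, h2]
  ring

/-- The density on `sphere c r` obtained by sweeping charges `q m` at `a m` onto the sphere. -/
noncomputable def sweptDensity (c : E₃) (r : ℝ) (a : ℕ → E₃) (q : ℕ → ℝ) (y : E₃) : ℝ :=
  ∑' m, q m * poissonDensity c r (a m) y

variable {c : E₃} {r δ : ℝ} {a : ℕ → E₃} {q : ℕ → ℝ}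

theorem norm_mul_poissonDensity_le (hr : 0 < r) (hδ : 0 < δ)
    (ha : ∀ m, ‖a m - c‖ ≤ r - δ) (m : ℕ) (y : E₃) :
    ‖q m * poissonDensity c r (a m) y‖ ≤ |q m| * (r ^ 2 / (4 * Real.pi * r * δ ^ 3)) := by
  have h1 := poissonDensity_nonneg hr ((ha m).trans (by linarith)) y
  have h2 := poissonDensity_le hr hδ (ha m) y
  rw [norm_mul, Real.norm_eq_abs, Real.norm_of_nonneg h1]
  gcongr

theorem summable_mul_poissonDensity (hr : 0 < r) (hδ : 0 < δ)
    (ha : ∀ m, ‖a m - c‖ ≤ r - δ) (hq : Summable q) (y : E₃) :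
    Summable fun m => q m * poissonDensity c r (a m) y :=
  Summable.of_norm_bounded (hq.abs.mul_right _)
    fun m => norm_mul_poissonDensity_le hr hδ ha m y

theorem abs_sweptDensity_le (hr : 0 < r) (hδ : 0 < δ)
    (ha : ∀ m, ‖a m - c‖ ≤ r - δ) (hq : Summable q) (y : E₃) :
    |sweptDensity c r a q y| ≤ ∑' m, |q m| * (r ^ 2 / (4 * Real.pi * r * δ ^ 3)) :=
  tsum_of_norm_bounded (hq.abs.mul_right _).hasSum
    fun m => norm_mul_poissonDensity_le hr hδ ha m y

theorem measurable_sweptDensity (hr : 0 < r) (hδ : 0 < δ)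
    (ha : ∀ m, ‖a m - c‖ ≤ r - δ) (hq : Summable q) : Measurable (sweptDensity c r a q) := by
  refine measurable_of_tendsto_metrizable
    (f := fun n y => ∑ m ∈ Finset.range n, q m * poissonDensity c r (a m) y) (fun n => ?_) ?_
  · have := fun m => measurable_poissonDensity c r (a m)
    fun_prop
  · rw [tendsto_pi_nhds]
    exact fun y => (summable_mul_poissonDensity hr hδ ha hq y).hasSum.tendsto_sum_nat

theorem sweptDensity_of_notMem {y : E₃} (hy : y ∉ sphere c r) : sweptDensity c r a q y = 0 := by
  simp [sweptDensity, poissonDensity, Set.indicator_of_notMem hy]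

theorem integral_sweptDensity (hr : 0 < r) (hδ : 0 < δ)
    (ha : ∀ m, ‖a m - c‖ ≤ r - δ) (hq : Summable q) :
    ∫ y, sweptDensity c r a q y ∂sphereMeasure c r = ∑' m, q m := by
  have ha' : ∀ m, ‖a m - c‖ < r := fun m => (ha m).trans_lt (by linarith)
  have hint : ∀ m, Integrable (fun y => q m * poissonDensity c r (a m) y) (sphereMeasure c r) :=
    fun m => Integrable.of_bound ((measurable_poissonDensity c r (a m)).const_mul _).aestronglyMeasurable _
      (.of_forall (norm_mul_poissonDensity_le hr hδ ha m))
  have h := hasSum_integral_of_summable_integral_norm hint ?_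
  · simp_rw [integral_const_mul, integral_poissonDensity hr (ha' _), mul_one] at h
    exact h.tsum_eq.symm
  · simp_rw [norm_mul, Real.norm_of_nonneg (poissonDensity_nonneg hr (ha' _).le _),
      integral_const_mul, integral_poissonDensity hr (ha' _), mul_one]
    exact hq.norm

theorem integral_sweptDensity_div_norm_sub (hr : 0 < r) (hδ : 0 < δ)
    (ha : ∀ m, ‖a m - c‖ ≤ r - δ) (hq : Summable q) {x : E₃} (hx : r ≤ ‖x - c‖) :
    ∫ y, sweptDensity c r a q y / ‖x - y‖ ∂sphereMeasure c r = ∑' m, q m / ‖x - a m‖ := by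
  have ha' : ∀ m, ‖a m - c‖ < r := fun m => (ha m).trans_lt (by linarith)
  have hint : ∀ m, Integrable (fun y => q m * (poissonDensity c r (a m) y / ‖x - y‖))
      (sphereMeasure c r) :=
    fun m => (integral_poissonDensity_div_norm_sub hr (ha' m) hx).1.const_mul _
  have h := hasSum_integral_of_summable_integral_norm hint ?_
  · simp_rw [integral_const_mul, (integral_poissonDensity_div_norm_sub hr (ha' _) hx).2,
      mul_one_div] at h
    rw [h.tsum_eq]
    refine integral_congr_ae (.of_forall fun y => ?_)
    simp only [sweptDensity, mul_div_assoc', tsum_div_const]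
  · have hnn : ∀ m y, 0 ≤ poissonDensity c r (a m) y / ‖x - y‖ := fun m y =>
      div_nonneg (poissonDensity_nonneg hr (ha' m).le y) (norm_nonneg _)
    simp_rw [norm_mul, Real.norm_of_nonneg (hnn _ _), integral_const_mul,
      (integral_poissonDensity_div_norm_sub hr (ha' _) hx).2]
    refine Summable.of_nonneg_of_le (fun m => by positivity) (fun m => ?_) (hq.norm.mul_right (1 / δ))
    have h1 : δ ≤ ‖x - a m‖ := by
      have h2 := norm_sub_norm_le (x - c) (a m - c)
      rw [sub_sub_sub_cancel_right] at h2
      have := ha m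
      linarith
    gcongr

end SweptCharges

/-! ### From interior charges to a density on both spheres. -/

section TwoSpheres

open Metric

local notation "E₃" => EuclideanSpace ℝ (Fin 3)

theorem boundaryMeasure_eq_add (c : Fin 2 → E₃) (r : Fin 2 → ℝ) {i j : Fin 2} (hij : i ≠ j) :
    boundaryMeasure c r = sphereMeasure (c i) (r i) + sphereMeasure (c j) (r j) := by
  rw [boundaryMeasure, Fin.sum_univ_two]
  fin_cases i <;> fin_cases j <;> simp_all [add_comm]

theorem ae_boundaryMeasure_iff (c : Fin 2 → E₃) (r : Fin 2 → ℝ) {P : E₃ → Prop} :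
    (∀ᵐ x ∂boundaryMeasure c r, P x) ↔ ∀ i, ∀ᵐ x ∂sphereMeasure (c i) (r i), P x := by
  rw [boundaryMeasure, Fin.sum_univ_two, ae_add_measure_iff, Fin.forall_fin_two]

theorem le_norm_sub_of_mem_sphere {c : Fin 2 → E₃} {r : Fin 2 → ℝ}
    (hd : r 0 + r 1 < dist (c 0) (c 1)) {i k : Fin 2} {x : E₃} (hx : x ∈ sphere (c i) (r i)) :
    r k ≤ ‖x - c k‖ := by
  by_cases hik : i = k
  · subst hik
    exact (mem_sphere_iff_norm.1 hx).ge
  · have h1 : r i + r k < dist (c i) (c k) := by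
      fin_cases i <;> fin_cases k <;> simp_all [add_comm, dist_comm]
    have h2 := dist_triangle_left (c i) (c k) x
    rw [mem_sphere.1 hx] at h2
    rw [← dist_eq_norm]
    linarith

theorem integrable_inv_norm_sub_boundaryMeasure {c : Fin 2 → E₃} {r : Fin 2 → ℝ}
    (hr : ∀ i, 0 < r i) (hd : r 0 + r 1 < dist (c 0) (c 1)) {k : Fin 2} {x : E₃}
    (hx : x ∈ sphere (c k) (r k)) :
    Integrable (fun y => 1 / ‖x - y‖) (boundaryMeasure c r) ∧
      ∫ y, 1 / ‖x - y‖ ∂boundaryMeasure c r ≤ 4 * Real.pi * (r 0 + r 1) := by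
  have h := fun i => integral_inv_norm_sub_sphereMeasure (hr i) (le_norm_sub_of_mem_sphere hd hx (k := i))
  have h' : ∀ i, 4 * Real.pi * r i ^ 2 / ‖x - c i‖ ≤ 4 * Real.pi * r i := fun i => by
    have h1 := le_norm_sub_of_mem_sphere hd hx (k := i)
    have h2 := hr i
    rw [div_le_iff₀ (h2.trans_le h1), pow_two, ← mul_assoc]
    gcongr
  rw [boundaryMeasure, Fin.sum_univ_two]
  refine ⟨(h 0).1.add_measure (h 1).1, ?_⟩
  rw [integral_add_measure (h 0).1 (h 1).1, (h 0).2, (h 1).2]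
  have := h' 0
  have := h' 1
  linarith

theorem singleLayer_ofReal (c : Fin 2 → E₃) (r : Fin 2 → ℝ) (φ : E₃ → ℝ) (x : E₃) :
    singleLayer c r (fun y => (φ y : ℂ)) x =
      ((-(1 / (4 * Real.pi)) * ∫ y, φ y / ‖x - y‖ ∂boundaryMeasure c r : ℝ) : ℂ) := by
  rw [singleLayer, ← integral_const_mul, ← integral_complex_ofReal]
  refine integral_congr_ae (.of_forall fun y => ?_)
  simp only [← Complex.ofReal_mul]
  congr 1
  simp only [div_eq_mul_inv, mul_inv]
  ring

theorem exists_density_of_charges {c : Fin 2 → E₃} {r : Fin 2 → ℝ}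
    (hr : ∀ i, 0 < r i) (hd : r 0 + r 1 < dist (c 0) (c 1)) {i j : Fin 2} (hij : i ≠ j)
    {a b : ℕ → E₃} {q s : ℕ → ℝ} (hq : Summable q) (hs : Summable s) {δ : ℝ} (hδ : 0 < δ)
    (ha : ∀ m, ‖a m - c i‖ ≤ r i - δ) (hb : ∀ m, ‖b m - c j‖ ≤ r j - δ)
    (hi : ∀ x ∈ sphere (c i) (r i), ∑' m, q m / ‖x - a m‖ - ∑' m, s m / ‖x - b m‖ = 1)
    (hj : ∀ x ∈ sphere (c j) (r j), ∑' m, q m / ‖x - a m‖ - ∑' m, s m / ‖x - b m‖ = 0) :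
    ∃ φ : E₃ → ℝ, Measurable φ ∧ (∃ M, ∀ y, |φ y| ≤ M) ∧
      (∀ k, ∀ x ∈ sphere (c k) (r k),
        singleLayer c r (fun y => (φ y : ℂ)) x = if k = i then 1 else 0) ∧
      ∫ y, φ y ∂sphereMeasure (c i) (r i) = -(4 * Real.pi * ∑' m, q m) ∧
      ∫ y, φ y ∂sphereMeasure (c j) (r j) = 4 * Real.pi * ∑' m, s m := by
  have hdisj : ∀ y, y ∈ sphere (c i) (r i) → y ∉ sphere (c j) (r j) := by
    intro y hyi hyj
    have h1 : r i + r j < dist (c i) (c j) := by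
      fin_cases i <;> fin_cases j <;> simp_all [add_comm, dist_comm]
    have h2 := dist_triangle_left (c i) (c j) y
    rw [mem_sphere.1 hyi, mem_sphere.1 hyj] at h2
    linarith
  have hpi := Real.pi_pos
  set f := sweptDensity (c i) (r i) a q with hf
  set g := sweptDensity (c j) (r j) b s with hg
  have hfm : Measurable f := measurable_sweptDensity (hr i) hδ ha hq
  have hgm : Measurable g := measurable_sweptDensity (hr j) hδ hb hs
  obtain ⟨M, hM⟩ : ∃ M, ∀ y, |-(4 * Real.pi) * (f y - g y)| ≤ M := by
    obtain ⟨A, h1⟩ : ∃ A, ∀ y, |f y - g y| ≤ A := ⟨_, fun y => (abs_sub (f y) (g y)).trans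
      (add_le_add (abs_sweptDensity_le (hr i) hδ ha hq y) (abs_sweptDensity_le (hr j) hδ hb hs y))⟩
    refine ⟨4 * Real.pi * A, fun y => ?_⟩
    rw [abs_mul, abs_neg, abs_of_pos (by positivity : 0 < 4 * Real.pi)]
    exact mul_le_mul_of_nonneg_left (h1 y) (by positivity)
  have hφi : ∀ y ∈ sphere (c i) (r i), -(4 * Real.pi) * (f y - g y) = -(4 * Real.pi) * f y := by
    intro y hy
    rw [hg, sweptDensity_of_notMem (hdisj y hy), sub_zero]
  have hφj : ∀ y ∈ sphere (c j) (r j), -(4 * Real.pi) * (f y - g y) = 4 * Real.pi * g y := by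
    intro y hy
    rw [hf, sweptDensity_of_notMem (fun h => hdisj y h hy)]
    ring
  -- The factor -4π cancels the normalisation -1/(4π) of the single layer potential.
  refine ⟨fun y => -(4 * Real.pi) * (f y - g y), by fun_prop, ⟨M, hM⟩, ?_, ?_, ?_⟩
  · intro k x hx
    have hint : Integrable (fun y => -(4 * Real.pi) * (f y - g y) / ‖x - y‖) (boundaryMeasure c r) := by
      have h1 := (integrable_inv_norm_sub_boundaryMeasure hr hd hx).1
      have h2 := h1.bdd_mul (f := fun y => -(4 * Real.pi) * (f y - g y)) (c := M)
        (by refine Measurable.aestronglyMeasurable ?_; fun_prop) (.of_forall hM)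
      simpa [div_eq_mul_inv] using h2
    rw [boundaryMeasure_eq_add c r hij] at hint
    rw [singleLayer_ofReal, boundaryMeasure_eq_add c r hij,
      integral_add_measure hint.left_of_add_measure hint.right_of_add_measure]
    have h1 : ∫ y, -(4 * Real.pi) * (f y - g y) / ‖x - y‖ ∂sphereMeasure (c i) (r i) =
        -(4 * Real.pi) * ∑' m, q m / ‖x - a m‖ := by
      rw [← integral_sweptDensity_div_norm_sub (hr i) hδ ha hq (le_norm_sub_of_mem_sphere hd hx),
        ← integral_const_mul]
      refine integral_congr_ae ?_
      filter_upwards [ae_mem_sphere (hr i)] with y hy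
      rw [hφi y hy, mul_div_assoc]
    have h2 : ∫ y, -(4 * Real.pi) * (f y - g y) / ‖x - y‖ ∂sphereMeasure (c j) (r j) =
        4 * Real.pi * ∑' m, s m / ‖x - b m‖ := by
      rw [← integral_sweptDensity_div_norm_sub (hr j) hδ hb hs (le_norm_sub_of_mem_sphere hd hx),
        ← integral_const_mul]
      refine integral_congr_ae ?_
      filter_upwards [ae_mem_sphere (hr j)] with y hy
      rw [hφj y hy, mul_div_assoc]
    rw [h1, h2]
    have h3 : -(1 / (4 * Real.pi)) * (-(4 * Real.pi) * ∑' m, q m / ‖x - a m‖ +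
        4 * Real.pi * ∑' m, s m / ‖x - b m‖) =
        ∑' m, q m / ‖x - a m‖ - ∑' m, s m / ‖x - b m‖ := by field_simp; ring
    rw [h3]
    by_cases hk : k = i
    · subst hk
      simp [hi x hx]
    · have hk' : k = j := by omega
      subst hk'
      simp [hj x hx, hk]
  · rw [← integral_sweptDensity (hr i) hδ ha hq, ← neg_mul (4 * Real.pi), ← integral_const_mul]
    refine integral_congr_ae ?_
    filter_upwards [ae_mem_sphere (hr i)] with y hy
    exact hφi y hy
  · rw [← integral_sweptDensity (hr j) hδ hb hs, ← integral_const_mul]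
    refine integral_congr_ae ?_
    filter_upwards [ae_mem_sphere (hr j)] with y hy
    exact hφj y hy

end TwoSpheres

/-! ### Symmetry of the single layer potential. -/

section Duality

open Metric

local notation "E₃" => EuclideanSpace ℝ (Fin 3)

/-- For |φ| ≤ M, the integral of |φ(x)|/|y - x| over x is at most 4πM(r₀ + r₁) for every y on ∂D, so
integrability of ψ suffices for Fubini. -/
theorem integrable_kernel_prod {c : Fin 2 → E₃} {r : Fin 2 → ℝ}
    (hr : ∀ i, 0 < r i) (hd : r 0 + r 1 < dist (c 0) (c 1)) {φ ψ : E₃ → ℂ}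
    (hφ : Measurable φ) {M : ℝ} (hM : ∀ y, ‖φ y‖ ≤ M) (hψ : Integrable ψ (boundaryMeasure c r)) :
    Integrable (fun z : E₃ × E₃ => φ z.1 *
      (((-(1 / (4 * Real.pi * ‖z.1 - z.2‖)) : ℝ) : ℂ) * ψ z.2))
      ((boundaryMeasure c r).prod (boundaryMeasure c r)) := by
  have hpi := Real.pi_pos
  have hM0 : 0 ≤ M := (norm_nonneg _).trans (hM 0)
  have hms : AEStronglyMeasurable (fun z : E₃ × E₃ => φ z.1 *
      (((-(1 / (4 * Real.pi * ‖z.1 - z.2‖)) : ℝ) : ℂ) * ψ z.2))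
      ((boundaryMeasure c r).prod (boundaryMeasure c r)) := by
    refine AEStronglyMeasurable.mul ?_ (AEStronglyMeasurable.mul ?_ hψ.1.comp_snd)
    · refine Measurable.aestronglyMeasurable ?_
      fun_prop
    · refine Measurable.aestronglyMeasurable ?_
      fun_prop
  have hmem : ∀ᵐ y ∂boundaryMeasure c r, ∃ k, y ∈ sphere (c k) (r k) := by
    rw [ae_boundaryMeasure_iff]
    intro k
    filter_upwards [ae_mem_sphere (hr k)] with y hy
    exact ⟨k, hy⟩
  have hnorm : ∀ x y, ‖φ x * (((-(1 / (4 * Real.pi * ‖x - y‖)) : ℝ) : ℂ) * ψ y)‖ =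
      ‖ψ y‖ / (4 * Real.pi) * (‖φ x‖ * (1 / ‖y - x‖)) := by
    intro x y
    rw [norm_mul, norm_mul, Complex.norm_real, norm_neg, Real.norm_of_nonneg (by positivity),
      norm_sub_rev y x, one_div, one_div, mul_inv (4 * Real.pi) ‖x - y‖]
    ring
  have hin : ∀ y, (∃ k, y ∈ sphere (c k) (r k)) →
      Integrable (fun x => ‖φ x‖ * (1 / ‖y - x‖)) (boundaryMeasure c r) := by
    rintro y ⟨k, hk⟩
    refine (integrable_inv_norm_sub_boundaryMeasure hr hd hk).1.bdd_mul (c := M)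
      hφ.norm.aestronglyMeasurable (.of_forall fun x => ?_)
    rw [norm_norm]
    exact hM x
  rw [integrable_prod_iff' hms]
  constructor
  · filter_upwards [hmem] with y hy
    rw [← integrable_norm_iff]
    · simp_rw [hnorm]
      exact (hin y hy).const_mul _
    · refine Measurable.aestronglyMeasurable ?_
      fun_prop
  · refine Integrable.mono' (hψ.norm.mul_const (M * (r 0 + r 1))) hms.norm.prod_swap.integral_prod_right' ?_
    filter_upwards [hmem] with y hy
    simp_rw [hnorm]
    rw [integral_const_mul, norm_mul, Real.norm_of_nonneg (by positivity), Real.norm_of_nonneg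
      (integral_nonneg fun x => by positivity)]
    obtain ⟨k, hk⟩ := hy
    obtain ⟨h1, h2⟩ := integrable_inv_norm_sub_boundaryMeasure hr hd hk
    have h3 : ∫ x, ‖φ x‖ * (1 / ‖y - x‖) ∂boundaryMeasure c r ≤
        M * (4 * Real.pi * (r 0 + r 1)) := by
      refine (integral_mono (hin y ⟨k, hk⟩) (h1.const_mul M) fun x => ?_).trans ?_
      · exact mul_le_mul_of_nonneg_right (hM x) (by positivity)
      · rw [integral_const_mul]
        gcongr
    calc ‖ψ y‖ / (4 * Real.pi) * ∫ x, ‖φ x‖ * (1 / ‖y - x‖) ∂boundaryMeasure c r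
        ≤ ‖ψ y‖ / (4 * Real.pi) * (M * (4 * Real.pi * (r 0 + r 1))) := by gcongr
      _ = ‖ψ y‖ * (M * (r 0 + r 1)) := by field_simp

theorem integral_mul_singleLayer_comm {c : Fin 2 → E₃} {r : Fin 2 → ℝ}
    (hr : ∀ i, 0 < r i) (hd : r 0 + r 1 < dist (c 0) (c 1)) {φ ψ : E₃ → ℂ}
    (hφ : Measurable φ) {M : ℝ} (hM : ∀ y, ‖φ y‖ ≤ M) (hψ : Integrable ψ (boundaryMeasure c r)) :
    ∫ x, φ x * singleLayer c r ψ x ∂boundaryMeasure c r =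
      ∫ x, ψ x * singleLayer c r φ x ∂boundaryMeasure c r := by
  have h := integral_integral_swap (f := fun x y => φ x *
    (((-(1 / (4 * Real.pi * ‖x - y‖)) : ℝ) : ℂ) * ψ y)) (integrable_kernel_prod hr hd hφ hM hψ)
  simp_rw [integral_const_mul] at h
  refine h.trans (integral_congr_ae (.of_forall fun y => ?_))
  simp only [singleLayer]
  rw [← integral_const_mul]
  refine integral_congr_ae (.of_forall fun x => ?_)
  simp only
  rw [norm_sub_rev]
  ring

theorem integral_mul_eq_of_ae_eq_ite {c : Fin 2 → E₃} {r : Fin 2 → ℝ} {f g : E₃ → ℂ}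
    (hf : Integrable f (boundaryMeasure c r)) {j : Fin 2}
    (hg : ∀ i, ∀ᵐ x ∂sphereMeasure (c i) (r i), g x = if i = j then 1 else 0) :
    ∫ x, f x * g x ∂boundaryMeasure c r = ∫ x, f x ∂sphereMeasure (c j) (r j) := by
  obtain ⟨k, hk⟩ : ∃ k : Fin 2, j ≠ k := ⟨j + 1, by fin_cases j <;> simp⟩
  rw [boundaryMeasure_eq_add c r hk] at hf ⊢
  have h1 : (fun x => f x * g x) =ᵐ[sphereMeasure (c j) (r j)] f := by
    filter_upwards [hg j] with x hx
    simp [hx]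
  have h2 : (fun x => f x * g x) =ᵐ[sphereMeasure (c k) (r k)] 0 := by
    filter_upwards [hg k] with x hx
    simp [hx, hk.symm]
  rw [integral_add_measure (hf.left_of_add_measure.congr h1.symm)
    ((integrable_zero _ _ _).congr h2.symm), integral_congr_ae h1, integral_congr_ae h2]
  simp

/-- Both sides are the pairing of `φ` and `ψ` through the symmetric kernel. An explicit `φ` thus
determines the coefficients for every admissible `ψ`. -/
theorem integral_sphere_eq_of_dual {c : Fin 2 → E₃} {r : Fin 2 → ℝ}
    (hr : ∀ i, 0 < r i) (hd : r 0 + r 1 < dist (c 0) (c 1)) {i j : Fin 2} {φ ψ : E₃ → ℂ}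
    (hφ : Measurable φ) {M : ℝ} (hM : ∀ y, ‖φ y‖ ≤ M) (hψ : MemLp ψ 2 (boundaryMeasure c r))
    (hφi : ∀ k, ∀ x ∈ sphere (c k) (r k), singleLayer c r φ x = if k = i then 1 else 0)
    (hψj : ∀ k, ∀ᵐ x ∂sphereMeasure (c k) (r k), singleLayer c r ψ x = if k = j then 1 else 0) :
    ∫ y, ψ y ∂sphereMeasure (c i) (r i) = ∫ y, φ y ∂sphereMeasure (c j) (r j) := by
  have hψ' : Integrable ψ (boundaryMeasure c r) := hψ.integrable one_le_two
  have hφ' : Integrable φ (boundaryMeasure c r) :=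
    Integrable.of_bound hφ.aestronglyMeasurable M (.of_forall hM)
  have h := integral_mul_singleLayer_comm hr hd hφ hM hψ'
  rw [integral_mul_eq_of_ae_eq_ite hφ' hψj, integral_mul_eq_of_ae_eq_ite (j := i) hψ'] at h
  · exact h.symm
  · intro k
    filter_upwards [ae_mem_sphere (hr k)] with x hx
    exact hφi k x hx

end Duality

/-! ### Conversion of hyperbolic sine series into exponential series. -/

section Series

theorem summable_inv_sinh_add_mul {a b : ℝ} (ha : 0 < a) (hb : 0 < b) :
    Summable fun m : ℕ => 1 / Real.sinh (b + m * a) := by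
  have h0 : 0 < Real.sinh b := Real.sinh_pos_iff.2 hb
  have hgeo : Summable fun m : ℕ => Real.exp (-a) ^ m :=
    summable_geometric_of_lt_one (Real.exp_pos _).le (Real.exp_lt_one_iff.2 (by linarith))
  refine Summable.of_nonneg_of_le (fun m => ?_) (fun m => ?_) (hgeo.mul_left (1 / Real.sinh b))
  · have : 0 < Real.sinh (b + m * a) := Real.sinh_pos_iff.2 (by positivity)
    positivity
  · have h1 : Real.sinh b * Real.exp (m * a) ≤ Real.sinh (b + m * a) := by
      rw [Real.sinh_add, ← Real.cosh_add_sinh, mul_add]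
      have h2 : 0 ≤ Real.sinh (m * a) := Real.sinh_nonneg_iff.2 (by positivity)
      have h3 := (Real.sinh_lt_cosh b).le
      nlinarith
    rw [← Real.exp_nat_mul, mul_neg, Real.exp_neg, ← one_div, div_mul_div_comm, one_mul]
    have := Real.exp_pos (m * a)
    exact one_div_le_one_div_of_le (by positivity) h1

theorem hasSum_exp_neg_odd_mul {t : ℝ} (ht : 0 < t) :
    HasSum (fun n : ℕ => Real.exp (-((2 * n + 1) * t))) (1 / (2 * Real.sinh t)) := by
  have h := (hasSum_geometric_of_lt_one (Real.exp_pos (-(2 * t))).le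
    (Real.exp_lt_one_iff.2 (by linarith))).mul_left (Real.exp (-t))
  suffices hval : 1 / (2 * Real.sinh t) = Real.exp (-t) * (1 - Real.exp (-(2 * t)))⁻¹ by
    rw [hval]
    refine (congrArg (fun f : ℕ → ℝ => HasSum f _) (funext fun n => ?_)).mpr h
    rw [← Real.exp_nat_mul, ← Real.exp_add]
    congr 1; ring
  · have h2 : Real.exp (-(2 * t)) = Real.exp (-t) * Real.exp (-t) := by
      rw [← Real.exp_add]; congr 1; ring
    have h3 : Real.exp (-t) < 1 := Real.exp_lt_one_iff.2 (by linarith)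
    have h4 : 1 - Real.exp (-t) * Real.exp (-t) ≠ 0 := by nlinarith [Real.exp_pos (-t)]
    rw [Real.sinh_eq, h2]
    have h5 : Real.exp t = (Real.exp (-t))⁻¹ := by rw [Real.exp_neg, inv_inv]
    rw [h5]
    have := (Real.exp_pos (-t)).ne'
    field_simp

theorem hasSum_exp_neg_succ_mul {s a b : ℝ} (hs : 0 < s) (ha : 0 < a) :
    HasSum (fun m : ℕ => Real.exp (-(s * ((m + 1) * a - b))))
      (Real.exp (s * b) / (Real.exp (s * a) - 1)) := by
  have h := (hasSum_geometric_of_lt_one (Real.exp_pos (-(s * a))).le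
    (Real.exp_lt_one_iff.2 (by nlinarith))).mul_left (Real.exp (s * b) * Real.exp (-(s * a)))
  suffices hval : Real.exp (s * b) / (Real.exp (s * a) - 1) =
      Real.exp (s * b) * Real.exp (-(s * a)) * (1 - Real.exp (-(s * a)))⁻¹ by
    rw [hval]
    refine (congrArg (fun f : ℕ → ℝ => HasSum f _) (funext fun m => ?_)).mpr h
    rw [← Real.exp_nat_mul, ← Real.exp_add, ← Real.exp_add]
    congr 1; ring
  · have h1 : 1 < Real.exp (s * a) := Real.one_lt_exp_iff.2 (by positivity)
    have h2 : Real.exp (s * a) - 1 ≠ 0 := by linarith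
    rw [Real.exp_neg]
    field_simp

/-- Both series are iterated sums of the positive double series exp(-(2n+1)((m+1)a - b)): summing
over n first gives 1/(2 sinh), over m first the exponential quotient. -/
theorem hasSum_exp_div_exp_sub_one {a b : ℝ} (ha : 0 < a) (hb : b < a) :
    HasSum (fun n : ℕ => Real.exp ((2 * n + 1) * b) / (Real.exp ((2 * n + 1) * a) - 1))
      (∑' m : ℕ, 1 / (2 * Real.sinh (a - b + m * a))) := by
  have ht : ∀ m : ℕ, 0 < (m + 1) * a - b := fun m => by
    have : 0 ≤ (m : ℝ) * a := by positivity
    linarith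
  have hm : ∀ m : ℕ, HasSum (fun n : ℕ => Real.exp (-((2 * n + 1) * ((m + 1) * a - b))))
      (1 / (2 * Real.sinh (a - b + m * a))) := fun m => by
    have := hasSum_exp_neg_odd_mul (ht m)
    rwa [show (m + 1) * a - b = a - b + m * a by ring] at this ⊢
  have hn : ∀ n : ℕ, HasSum (fun m : ℕ => Real.exp (-((2 * n + 1) * ((m + 1) * a - b))))
      (Real.exp ((2 * n + 1) * b) / (Real.exp ((2 * n + 1) * a) - 1)) := fun n =>
    hasSum_exp_neg_succ_mul (by positivity) ha
  have hS : Summable fun z : ℕ × ℕ => Real.exp (-((2 * (z.2 : ℝ) + 1) * ((z.1 + 1) * a - b))) := by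
    rw [summable_prod_of_nonneg fun z => (Real.exp_pos _).le]
    refine ⟨fun m => (hm m).summable, ?_⟩
    simp_rw [(hm _).tsum_eq]
    refine ((summable_inv_sinh_add_mul ha (sub_pos.2 hb)).mul_left (1 / 2)).congr fun m => ?_
    rw [div_mul_div_comm, one_mul]
  have h1 := hS.hasSum.prod_fiberwise hm
  have h2 := ((Equiv.prodComm ℕ ℕ).hasSum_iff.2 hS.hasSum).prod_fiberwise hn
  rwa [h1.tsum_eq]

end Series

/-! ### Image charges in bispherical parameters. -/

section Bispherical

open Real

/-- The bound is coth ξ - 1, as coth decreases to 1. Multiplied by α it becomes r e^{-ξ} < r, which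
keeps all image charges uniformly inside their ball. -/
theorem cosh_div_sinh_sub {η ξ : ℝ} (hξ : 0 < ξ) (hη : ξ ≤ η) :
    |cosh η / sinh η - cosh ξ / sinh ξ| ≤ exp (-ξ) / sinh ξ := by
  have h1 : 0 < sinh ξ := sinh_pos_iff.2 hξ
  have h2 : 0 < sinh η := sinh_pos_iff.2 (hξ.trans_le hη)
  have h3 : cosh η / sinh η - cosh ξ / sinh ξ = -(sinh (η - ξ) / sinh η / sinh ξ) := by
    rw [sinh_sub]; field_simp; ring
  have h4 : 0 ≤ sinh (η - ξ) := sinh_nonneg_iff.2 (by linarith)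
  have h5 : sinh (η - ξ) ≤ exp (-ξ) * sinh η := by
    rw [sinh_eq, sinh_eq, sub_eq_add_neg η ξ, exp_add]
    have h6 : exp (-ξ) * exp (-η) ≤ exp (-(η + -ξ)) := by
      rw [← exp_add]
      exact exp_le_exp.2 (by linarith)
    linarith
  rw [h3, abs_neg, abs_of_nonneg (by positivity)]
  gcongr
  rwa [div_le_iff₀ h2]

variable {E : Type*} [NormedAddCommGroup E] [InnerProductSpace ℝ E]

/-- The hypothesis `hy` is the equation of the coordinate sphere τ. The right side is invariant
under η ↦ τ - η, which is the image principle for that sphere. -/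
theorem sinh_sq_mul_norm_sub_sq {e y : E} (he : ‖e‖ = 1) {α η τ : ℝ} (hη : sinh η ≠ 0)
    (hτ : sinh τ ≠ 0) (hy : ‖y‖ ^ 2 + α ^ 2 = 2 * inner ℝ y e * α * (cosh τ / sinh τ)) :
    (sinh η * ‖y - (α * (cosh η / sinh η)) • e‖) ^ 2 =
      α ^ 2 + 2 * inner ℝ y e * α * (sinh (η - τ) * sinh η) / sinh τ := by
  rw [mul_pow, norm_sub_sq_real, norm_smul, he, inner_smul_right, norm_eq_abs, mul_one, sq_abs,
    sinh_sub]
  have h1 : ‖y‖ ^ 2 = 2 * inner ℝ y e * α * (cosh τ / sinh τ) - α ^ 2 := by linarith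
  rw [h1]
  field_simp
  rw [cosh_sq η]
  ring

/-- Point charges on the axis whose bispherical parameters are interchanged by the inversion in a
coordinate sphere produce the same potential on that sphere. -/
theorem div_norm_sub_eq_of_image {e y : E} (he : ‖e‖ = 1) {α η η' τ : ℝ} (hη : 0 < η)
    (hη' : 0 < η') (hτ : τ ≠ 0) (hτη : η = τ + η')
    (hy : ‖y‖ ^ 2 + α ^ 2 = 2 * inner ℝ y e * α * (cosh τ / sinh τ)) :
    α / sinh η / ‖y - (α * (cosh η / sinh η)) • e‖ =
      α / sinh η' / ‖y + (α * (cosh η' / sinh η')) • e‖ := by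
  have hs := sinh_pos_iff.2 hη
  have hs' := sinh_pos_iff.2 hη'
  have hs'' : sinh τ ≠ 0 := sinh_ne_zero.2 hτ
  have h1 := sinh_sq_mul_norm_sub_sq he hs.ne' hs'' hy
  have h2 := sinh_sq_mul_norm_sub_sq he (η := -η') (by simpa using hs'.ne') hs'' hy
  have h3 : y - (α * (cosh (-η') / sinh (-η'))) • e = y + (α * (cosh η' / sinh η')) • e := by
    rw [cosh_neg, sinh_neg, div_neg, mul_neg, neg_smul, sub_neg_eq_add]
  have h4 : sinh (-η' - τ) * sinh (-η') = sinh (η - τ) * sinh η := by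
    rw [show -η' - τ = -η by rw [hτη]; ring, show η - τ = η' by rw [hτη]; ring, sinh_neg, sinh_neg]
    ring
  rw [h3, h4, ← h1, sinh_neg, neg_mul, neg_sq,
    sq_eq_sq₀ (by positivity) (by positivity)] at h2
  rw [div_div, div_div, h2]

end Bispherical

/-! ### The infinite system of images for two spheres. -/

section Images

open Metric

local notation "E₃" => EuclideanSpace ℝ (Fin 3)

theorem bisphericalAlpha_pos {r₁ r₂ ε : ℝ} (h₁ : 0 < r₁) (h₂ : 0 < r₂) (hε : 0 < ε) :
    0 < bisphericalAlpha r₁ r₂ ε := by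
  unfold bisphericalAlpha
  positivity

/-- Each term is √(r² + α²), the distance from the bispherical origin to a centre; for this α the
square roots are rational in the radii and ε. -/
theorem mul_cosh_arsinh_bisphericalAlpha {r₁ r₂ ε : ℝ} (h₁ : 0 < r₁) (h₂ : 0 < r₂) (hε : 0 < ε) :
    r₁ * Real.cosh (Real.arsinh (bisphericalAlpha r₁ r₂ ε / r₁)) +
      r₂ * Real.cosh (Real.arsinh (bisphericalAlpha r₁ r₂ ε / r₂)) = r₁ + r₂ + ε := by
  have hsq : bisphericalAlpha r₁ r₂ ε ^ 2 =
      ε * (2 * r₁ + ε) * (2 * r₂ + ε) * (2 * r₁ + 2 * r₂ + ε) / (2 * (r₁ + r₂ + ε)) ^ 2 := by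
    rw [bisphericalAlpha, div_pow, Real.sq_sqrt (by positivity)]
  have e1 : r₁ * Real.cosh (Real.arsinh (bisphericalAlpha r₁ r₂ ε / r₁)) =
      (2 * r₁ * (r₁ + r₂ + ε) + ε * (2 * r₂ + ε)) / (2 * (r₁ + r₂ + ε)) := by
    rw [Real.cosh_arsinh, mul_comm, ← eq_div_iff h₁.ne', Real.sqrt_eq_iff_eq_sq (by positivity)
      (by positivity), div_pow, hsq]
    field_simp
    ring
  have e2 : r₂ * Real.cosh (Real.arsinh (bisphericalAlpha r₁ r₂ ε / r₂)) =
      (2 * r₂ * (r₁ + r₂ + ε) + ε * (2 * r₁ + ε)) / (2 * (r₁ + r₂ + ε)) := by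
    rw [Real.cosh_arsinh, mul_comm, ← eq_div_iff h₂.ne', Real.sqrt_eq_iff_eq_sq (by positivity)
      (by positivity), div_pow, hsq]
    field_simp
    ring
  rw [e1, e2]
  field_simp
  ring

theorem norm_sq_add_sq_of_mem_sphere {e y : E₃} (he : ‖e‖ = 1) {α τ : ℝ} (hτ : τ ≠ 0)
    (hy : ‖y - (α * (Real.cosh τ / Real.sinh τ)) • e‖ ^ 2 = (α / Real.sinh τ) ^ 2) :
    ‖y‖ ^ 2 + α ^ 2 = 2 * inner ℝ y e * α * (Real.cosh τ / Real.sinh τ) := by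
  have hs : Real.sinh τ ≠ 0 := Real.sinh_ne_zero.2 hτ
  rw [norm_sub_sq_real, norm_smul, he, inner_smul_right, Real.norm_eq_abs, mul_one, sq_abs] at hy
  have h1 : (α * (Real.cosh τ / Real.sinh τ)) ^ 2 = α ^ 2 + (α / Real.sinh τ) ^ 2 := by
    field_simp
    rw [Real.cosh_sq]
  rw [h1] at hy
  linarith

theorem exists_image_density {c : Fin 2 → E₃} {r ξ : Fin 2 → ℝ} {α : ℝ}
    (hr : ∀ i, 0 < r i) (hd : r 0 + r 1 < dist (c 0) (c 1)) (hα : 0 < α) (hξ : ∀ i, 0 < ξ i)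
    (hrξ : ∀ i, r i = α / Real.sinh (ξ i)) {i j : Fin 2} (hij : i ≠ j)
    (hdist : dist (c i) (c j) = r i * Real.cosh (ξ i) + r j * Real.cosh (ξ j)) :
    ∃ φ : E₃ → ℝ, Measurable φ ∧ (∃ M, ∀ y, |φ y| ≤ M) ∧
      (∀ k, ∀ x ∈ sphere (c k) (r k),
        singleLayer c r (fun y => (φ y : ℂ)) x = if k = i then 1 else 0) ∧
      ∫ y, φ y ∂sphereMeasure (c i) (r i) =
        -(4 * Real.pi * ∑' m : ℕ, α / Real.sinh (ξ i + m * (ξ i + ξ j))) ∧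
      ∫ y, φ y ∂sphereMeasure (c j) (r j) =
        4 * Real.pi * ∑' m : ℕ, α / Real.sinh ((ξ i + ξ j) + m * (ξ i + ξ j)) := by
  set A := ξ i + ξ j with hA
  have hA0 : 0 < A := add_pos (hξ i) (hξ j)
  have hsinh : ∀ k, 0 < Real.sinh (ξ k) := fun k => Real.sinh_pos_iff.2 (hξ k)
  have hcothr : ∀ k, r k * Real.cosh (ξ k) = α * (Real.cosh (ξ k) / Real.sinh (ξ k)) := fun k => by
    rw [hrξ]; ring
  set d := dist (c i) (c j) with hddef
  have hd0 : 0 < d := by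
    rw [hdist]
    have := hr i
    have := hr j
    have := Real.cosh_pos (ξ i)
    have := Real.cosh_pos (ξ j)
    positivity
  set e : E₃ := d⁻¹ • (c i - c j) with he
  have he1 : ‖e‖ = 1 := by
    rw [he, norm_smul, norm_inv, Real.norm_of_nonneg hd0.le, ← dist_eq_norm, ← hddef,
      inv_mul_cancel₀ hd0.ne']
  have hde : c i - c j = d • e := by rw [he, smul_inv_smul₀ hd0.ne']
  -- Bispherical origin: the centres lie at α coth ξ_i and -α coth ξ_j along `e`, the second because
  -- of `hdist`.
  set O : E₃ := c i - (α * (Real.cosh (ξ i) / Real.sinh (ξ i))) • e with hO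
  have hci : c i = O + (α * (Real.cosh (ξ i) / Real.sinh (ξ i))) • e := by rw [hO]; abel
  have hcj : c j = O - (α * (Real.cosh (ξ j) / Real.sinh (ξ j))) • e := by
    rw [hO, ← hcothr, ← hcothr, sub_sub, ← add_smul, ← hdist, ← hde]; abel
  have hηi : ∀ m : ℕ, ξ i ≤ ξ i + m * A := fun m => le_add_of_nonneg_right (by positivity)
  have hηj : ∀ m : ℕ, ξ j ≤ A + m * A := fun m => by
    have : 0 ≤ m * A := by positivity
    have := hξ i
    linarith
  have hηi0 : ∀ m : ℕ, 0 < ξ i + m * A := fun m => (hξ i).trans_le (hηi m)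
  have hηj0 : ∀ m : ℕ, 0 < A + m * A := fun m => (hξ j).trans_le (hηj m)
  set a : ℕ → E₃ := fun m => O + (α * (Real.cosh (ξ i + m * A) / Real.sinh (ξ i + m * A))) • e
    with ha
  set b : ℕ → E₃ := fun m => O - (α * (Real.cosh (A + m * A) / Real.sinh (A + m * A))) • e with hb
  have hexp : ∀ k, 0 < r k - r k * Real.exp (-ξ k) := fun k => by
    have h1 : Real.exp (-ξ k) < 1 := Real.exp_lt_one_iff.2 (by linarith [hξ k])
    have := hr k
    nlinarith
  set δ := min (r i - r i * Real.exp (-ξ i)) (r j - r j * Real.exp (-ξ j)) with hδdef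
  have hδ : 0 < δ := lt_min (hexp i) (hexp j)
  have hai : ∀ m, ‖a m - c i‖ ≤ r i - δ := fun m => by
    have h1 : a m - c i = (α * (Real.cosh (ξ i + m * A) / Real.sinh (ξ i + m * A) -
        Real.cosh (ξ i) / Real.sinh (ξ i))) • e := by
      rw [hci]; simp only [ha]; module
    have h2 : α * (Real.exp (-ξ i) / Real.sinh (ξ i)) = r i * Real.exp (-ξ i) := by rw [hrξ]; ring
    rw [h1, norm_smul, he1, mul_one, norm_mul, Real.norm_of_nonneg hα.le, Real.norm_eq_abs]
    refine (mul_le_mul_of_nonneg_left (cosh_div_sinh_sub (hξ i) (hηi m)) hα.le).trans ?_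
    rw [h2]
    have := min_le_left (r i - r i * Real.exp (-ξ i)) (r j - r j * Real.exp (-ξ j))
    linarith
  have hbj : ∀ m, ‖b m - c j‖ ≤ r j - δ := fun m => by
    have h1 : b m - c j = -((α * (Real.cosh (A + m * A) / Real.sinh (A + m * A) -
        Real.cosh (ξ j) / Real.sinh (ξ j))) • e) := by
      rw [hcj]; simp only [hb]; module
    have h2 : α * (Real.exp (-ξ j) / Real.sinh (ξ j)) = r j * Real.exp (-ξ j) := by rw [hrξ]; ring
    rw [h1, norm_neg, norm_smul, he1, mul_one, norm_mul, Real.norm_of_nonneg hα.le,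
      Real.norm_eq_abs]
    refine (mul_le_mul_of_nonneg_left (cosh_div_sinh_sub (hξ j) (hηj m)) hα.le).trans ?_
    rw [h2]
    have := min_le_right (r i - r i * Real.exp (-ξ i)) (r j - r j * Real.exp (-ξ j))
    linarith
  have hq : Summable fun m : ℕ => α / Real.sinh (ξ i + m * A) :=
    ((summable_inv_sinh_add_mul hA0 (hξ i)).mul_left α).congr fun m => mul_one_div _ _
  have hs : Summable fun m : ℕ => α / Real.sinh (A + m * A) :=
    ((summable_inv_sinh_add_mul hA0 hA0).mul_left α).congr fun m => mul_one_div _ _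
  have hsuba : ∀ x m, x - a m =
      (x - O) - (α * (Real.cosh (ξ i + m * A) / Real.sinh (ξ i + m * A))) • e := fun x m => by
    simp only [ha]; abel
  have hsubb : ∀ x m, x - b m =
      (x - O) + (α * (Real.cosh (A + m * A) / Real.sinh (A + m * A))) • e := fun x m => by
    simp only [hb]; abel
  refine exists_density_of_charges hr hd hij (a := a) (b := b) hq hs hδ hai hbj ?_ ?_
  · intro x hx
    have hxO : ‖x - O‖ ^ 2 + α ^ 2 =
        2 * inner ℝ (x - O) e * α * (Real.cosh (ξ i) / Real.sinh (ξ i)) := by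
      refine norm_sq_add_sq_of_mem_sphere he1 (hξ i).ne' ?_
      rw [sub_sub, ← hci, mem_sphere_iff_norm.1 hx, ← hrξ]
    -- On sphere i, with τ = ξ_i, charge m + 1 inside is the image of charge m in the other ball;
    -- only charge 0, of size r_i at the centre, stays unmatched.
    have himg : ∀ m : ℕ, α / Real.sinh (ξ i + (m + 1 : ℕ) * A) / ‖x - a (m + 1)‖ =
        α / Real.sinh (A + m * A) / ‖x - b m‖ := fun m => by
      rw [hsuba, hsubb]
      refine div_norm_sub_eq_of_image he1 (hηi0 _) (hηj0 _) (hξ i).ne' ?_ hxO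
      push_cast; ring
    have hsum : Summable fun m : ℕ => α / Real.sinh (ξ i + m * A) / ‖x - a m‖ := by
      refine Summable.of_nonneg_of_le (fun m => ?_) (fun m => ?_) (hq.mul_right (1 / δ))
      · have := Real.sinh_pos_iff.2 (hηi0 m)
        positivity
      · have h1 : δ ≤ ‖x - a m‖ := by
          have h2 := norm_sub_norm_le (x - c i) (a m - c i)
          rw [sub_sub_sub_cancel_right, mem_sphere_iff_norm.1 hx] at h2
          have := hai m
          linarith
        have := Real.sinh_pos_iff.2 (hηi0 m)
        rw [div_eq_mul_one_div (α / Real.sinh (ξ i + m * A))]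
        gcongr
    rw [hsum.tsum_eq_zero_add, tsum_congr himg, add_sub_cancel_right]
    have ha0 : a 0 = c i := by rw [hci]; simp [ha]
    rw [ha0, mem_sphere_iff_norm.1 hx, Nat.cast_zero, zero_mul, add_zero, ← hrξ, div_self (hr i).ne']
  · intro x hx
    have hxO : ‖x - O‖ ^ 2 + α ^ 2 =
        2 * inner ℝ (x - O) e * α * (Real.cosh (-ξ j) / Real.sinh (-ξ j)) := by
      refine norm_sq_add_sq_of_mem_sphere he1 (neg_ne_zero.2 (hξ j).ne') ?_
      have h1 : x - O - (α * (Real.cosh (-ξ j) / Real.sinh (-ξ j))) • e = x - c j := by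
        rw [hcj, Real.cosh_neg, Real.sinh_neg, div_neg]; module
      rw [h1, mem_sphere_iff_norm.1 hx, Real.sinh_neg, div_neg, neg_sq, ← hrξ]
    -- On sphere j, with τ = -ξ_j, charges of equal index are images of each other, so nothing is
    -- left over.
    rw [sub_eq_zero]
    refine tsum_congr fun m => ?_
    rw [hsuba, hsubb]
    refine div_norm_sub_eq_of_image he1 (hηi0 _) (hηj0 _) (neg_ne_zero.2 (hξ j).ne') ?_ hxO
    rw [hA]; ring

end Images

/-! ### Assembly of the capacitance coefficients. -/

theorem tsum_exp_div_exp_sub_one {α a b : ℝ} (ha : 0 < a) (hb : b < a) :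
    8 * Real.pi * α * ∑' n : ℕ, Real.exp ((2 * n + 1) * b) / (Real.exp ((2 * n + 1) * a) - 1) =
      4 * Real.pi * ∑' m : ℕ, α / Real.sinh (a - b + m * a) := by
  rw [(hasSum_exp_div_exp_sub_one ha hb).tsum_eq, ← tsum_mul_left, ← tsum_mul_left]
  refine tsum_congr fun m => ?_
  rw [mul_comm (2 : ℝ), ← div_div]
  ring

theorem lemma4p2 (c : Fin 2 → EuclideanSpace ℝ (Fin 3)) (r : Fin 2 → ℝ) (ε α : ℝ) (ξ : Fin 2 → ℝ)
    (hr : ∀ i, 0 < r i) (hε : 0 < ε) (hc : dist (c 0) (c 1) = r 0 + r 1 + ε)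
    (hα : α = bisphericalAlpha (r 0) (r 1) ε) (hξ : ∀ i, ξ i = Real.arsinh (α / r i)) :
    (∃ ψ, IsCapacitanceDensity c r ψ) ∧
    Summable (fun n : ℕ => Real.exp ((2 * n + 1) * ξ 1) /
      (Real.exp ((2 * n + 1) * (ξ 0 + ξ 1)) - 1)) ∧
    Summable (fun n : ℕ => Real.exp ((2 * n + 1) * ξ 0) /
      (Real.exp ((2 * n + 1) * (ξ 0 + ξ 1)) - 1)) ∧
    Summable (fun n : ℕ => 1 / (Real.exp ((2 * n + 1) * (ξ 0 + ξ 1)) - 1)) ∧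
    ∀ ψ, IsCapacitanceDensity c r ψ →
      capacitanceMatrix c r ψ 0 0 = ((8 * Real.pi * α * ∑' n : ℕ, Real.exp ((2 * n + 1) * ξ 1) /
        (Real.exp ((2 * n + 1) * (ξ 0 + ξ 1)) - 1) : ℝ) : ℂ) ∧
      capacitanceMatrix c r ψ 1 1 = ((8 * Real.pi * α * ∑' n : ℕ, Real.exp ((2 * n + 1) * ξ 0) /
        (Real.exp ((2 * n + 1) * (ξ 0 + ξ 1)) - 1) : ℝ) : ℂ) ∧
      capacitanceMatrix c r ψ 0 1 = ((-(8 * Real.pi * α * ∑' n : ℕ, 1 /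
        (Real.exp ((2 * n + 1) * (ξ 0 + ξ 1)) - 1)) : ℝ) : ℂ) ∧
      capacitanceMatrix c r ψ 1 0 = ((-(8 * Real.pi * α * ∑' n : ℕ, 1 /
        (Real.exp ((2 * n + 1) * (ξ 0 + ξ 1)) - 1)) : ℝ) : ℂ) := by
  have hα0 : 0 < α := hα ▸ bisphericalAlpha_pos (hr 0) (hr 1) hε
  have hξ0 : ∀ i, 0 < ξ i := fun i => by
    rw [hξ, Real.arsinh_pos_iff]
    exact div_pos hα0 (hr i)
  have hrξ : ∀ i, r i = α / Real.sinh (ξ i) := fun i => by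
    rw [hξ, Real.sinh_arsinh, div_div_cancel₀ hα0.ne']
  have hd : r 0 + r 1 < dist (c 0) (c 1) := by rw [hc]; linarith
  have hdist : dist (c 0) (c 1) = r 0 * Real.cosh (ξ 0) + r 1 * Real.cosh (ξ 1) := by
    rw [hc, hξ, hξ, hα, mul_cosh_arsinh_bisphericalAlpha (hr 0) (hr 1) hε]
  have hA : 0 < ξ 0 + ξ 1 := add_pos (hξ0 0) (hξ0 1)
  -- The off-diagonal series is the case b = 0 of the general one; the diagonal ones have b = ξ 1
  -- and b = ξ 0.
  have hone : ∀ n : ℕ, 1 / (Real.exp ((2 * n + 1) * (ξ 0 + ξ 1)) - 1) =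
      Real.exp ((2 * n + 1) * 0) / (Real.exp ((2 * n + 1) * (ξ 0 + ξ 1)) - 1) := fun n => by
    rw [mul_zero, Real.exp_zero]
  obtain ⟨φ, hφm, ⟨M, hM⟩, hφ, hφ0, hφ1⟩ :=
    exists_image_density hr hd hα0 hξ0 hrξ (zero_ne_one (α := Fin 2)) hdist
  obtain ⟨χ, hχm, ⟨N, hN⟩, hχ, hχ1, hχ0⟩ := exists_image_density hr hd hα0 hξ0 hrξ
    (one_ne_zero (α := Fin 2)) (by rw [dist_comm, hdist, add_comm])
  have hmem : ∀ (f : EuclideanSpace ℝ (Fin 3) → ℝ) (M : ℝ), Measurable f → (∀ y, |f y| ≤ M) →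
      MemLp (fun y => (f y : ℂ)) 2 (boundaryMeasure c r) := fun f M hf hM =>
    MemLp.of_bound (by fun_prop) M (.of_forall fun y => by
      rw [Complex.norm_real]; exact hM y)
  have hφc : Measurable fun y => (φ y : ℂ) := by fun_prop
  have hχc : Measurable fun y => (χ y : ℂ) := by fun_prop
  have hMc : ∀ y, ‖(φ y : ℂ)‖ ≤ M := fun y => by rw [Complex.norm_real]; exact hM y
  have hNc : ∀ y, ‖(χ y : ℂ)‖ ≤ N := fun y => by rw [Complex.norm_real]; exact hN y
  rw [add_comm (ξ 1) (ξ 0)] at hχ0 hχ1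
  have e0 : ξ 0 + ξ 1 - ξ 1 = ξ 0 := by ring
  have e1 : ξ 0 + ξ 1 - ξ 0 = ξ 1 := by ring
  refine ⟨⟨![fun y => (φ y : ℂ), fun y => (χ y : ℂ)], ?_⟩, ?_, ?_, ?_, ?_⟩
  · refine Fin.forall_fin_two.2 ⟨⟨hmem φ M hφm hM, fun i => ?_⟩, ⟨hmem χ N hχm hN, fun i => ?_⟩⟩
    · filter_upwards [ae_mem_sphere (hr i)] with x hx
      exact hφ i x hx
    · filter_upwards [ae_mem_sphere (hr i)] with x hx
      exact hχ i x hx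
  · exact (hasSum_exp_div_exp_sub_one hA (by linarith [hξ0 0])).summable
  · exact (hasSum_exp_div_exp_sub_one hA (by linarith [hξ0 1])).summable
  · simp_rw [hone]
    exact (hasSum_exp_div_exp_sub_one hA hA).summable
  · intro ψ hψ
    simp only [capacitanceMatrix, Matrix.of_apply]
    simp_rw [hone]
    rw [tsum_exp_div_exp_sub_one hA (by linarith [hξ0 0]),
      tsum_exp_div_exp_sub_one hA (by linarith [hξ0 1]), tsum_exp_div_exp_sub_one hA hA, e0, e1,
      sub_zero]
    refine ⟨?_, ?_, ?_, ?_⟩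
    · rw [integral_sphere_eq_of_dual hr hd hφc hMc (hψ 0).1 hφ (hψ 0).2, integral_complex_ofReal, hφ0]
      push_cast; ring
    · rw [integral_sphere_eq_of_dual hr hd hχc hNc (hψ 1).1 hχ (hψ 1).2, integral_complex_ofReal, hχ1]
      push_cast; ring
    -- Duality swaps the indices: the integral of `ψ 1` over sphere 0 is that of `φ`, the density
    -- for sphere 0, over sphere 1.
    · rw [integral_sphere_eq_of_dual hr hd hφc hMc (hψ 1).1 hφ (hψ 1).2, integral_complex_ofReal, hφ1]
      push_cast; ring
    · rw [integral_sphere_eq_of_dual hr hd hχc hNc (hψ 0).1 hχ (hψ 0).2, integral_complex_ofReal, hχ0]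
      push_cast; ring
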